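/- **Setting.** Let $\mathcal X\subset\mathbb R^d$ be compact, let labels lie in $\{0,1\}$ and predictions in $[0,1]$, and put $\mathcal D=\mathcal X\times\{0,1\}$, with Lebesgue measure $\lambda$ := (Lebesgue measure on $\mathcal X$) $\otimes$ (counting measure on $\{0,1\}$). Let $\ell:[0,1]^2\to\mathbb R$ be a continuous loss such that (i) $\ell\ge 0$ and $\ell(y,y')=0$ iff $y=y'$; (ii) for every $q\in[0,1]$ the function $y\mapsto q\,\ell(y,1)+(1-q)\,\ell(y,0)$ has a unique minimizer $y_q^*$ on $[0,1]$, and $q\mapsto y_q^*$ is strictly increasing. Let $\mathcal P_B$ be the set of probability measures $\mu$ on $\mathcal D$ whose marginal $\mu^X$ on $\mathcal X$ is absolutely continuous with respect to Lebesgue measure and for which $p(x)=\mathbb P_\mu(Y=1\mid X=x)$ has an upper semicontinuous version; fix $\mu\in\mathcal P_B$ and such a version $p:\mathcal X\to[0,1]$. Let $\mathcal D_n$ be the set of the first $n$ terms of an i.i.d. sequence with law $\mu$. **Pruning.** A score-based pruning algorithm (SBPA) with score $g:\mathcal D\to\mathbb R$ is a map $\mathcal A$ that sends a finite $Z\subset\mathcal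 D$ and a level $r\in(0,1]$ to a subset $\mathcal A(Z,r)\subset Z$ such that, whenever $k:=\lfloor r|Z|\rfloor\ge 1$ and the scores of the points of $Z$ are pairwise distinct, $\mathcal A(Z,r)=\{z\in Z: g(z)\le g^{(k)}\}$, where $g^{(k)}$ is the $k$-th smallest of the scores $(g(z))_{z\in Z}$ (the treatment of ties is arbitrary). The score is *adapted* if $g$ is continuous on $\mathcal D$ and $\lambda(g^{-1}(\{c\}))=0$ for all $c\in g(\mathcal D)$. It *depends on the labels* if there is $x\in\operatorname{supp}\mu^X$ with $g(x,0)\ne g(x,1)$ at which both labels can happen: $p(x)\in(0,1)$ and $(x,0),(x,1)\in\operatorname{supp}\mu$. **Networks.** Let $\sigma:\mathbb R\to\mathbb R$ be continuous and not a polynomial, and suppose that there is a point near which $\sigma$ is differentiable and at which $\sigma'$ is continuous and nonzero. Let $\rho:\mathbb R\to\mathbb R$ be an output map that is continuous and nondecreasing with $[0,1]\subset\overline{\rho(\mathbb R)}$ (for instance the identity, i.e. an affine output layer; the truncation to $[0,1]$; or the logistic function). Fix $H\ge1$. For $K\ge 1$ and $R>0$, $FFNN^\sigma_{H,K}(R)$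 is the family of fully-connected feed-forward networks $x\mapsto\rho(c^\top h^{(H)}(x)+c_0)$ with $h^{(0)}(x)=x$, $h^{(j)}=\sigma(W_jh^{(j-1)}+b_j)\in\mathbb R^K$ for $1\le j\le H$, all weights and biases in $[-R,R]$, and predictions in $[0,1]$ for all $x\in\mathcal X$. Let $\mathcal W$ be its set of parameters, write $y_{out}(\cdot;w)$ for the network with parameter $w\in\mathcal W$, and put $$\mathcal L(w)=\mathbb E_\mu\,\ell(y_{out}(X;w),Y),\qquad \mathcal L_n^{\mathcal A,r}(w)=\frac1{|\mathcal A(\mathcal D_n,r)|}\sum_{(x,y)\in\mathcal A(\mathcal D_n,r)}\ell(y_{out}(x;w),y).$$ $\mathcal A$ is *consistent* on the family if for every $r\in(0,1]$ and every $w\in\mathcal W$, $\mathcal L_n^{\mathcal A,r}(w)\to\mathcal L(w)$ almost surely. For an exact training algorithm, i.e. a choice $w_n^{\mathcal A,r}\in\operatorname{argmin}_{\mathcal W}\mathcal L_n^{\mathcal A,r}$ for all $r\in(0,1]$ and all $n$ (almost surely), $\mathcal A$ is *valid* on the family if for every $r\in(0,1]$, $\mathcal L(w_n^{\mathcal A,r})-\min_{w\in\mathcal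 W}\mathcal L(w)\to0$ almost surely. **Corollary (wide neural networks).** For every SBPA $\mathcal A$ with an adapted score $g$ there exist a radius $R_0$ and a width $K_0$ such that $\mathcal A$ is not consistent on $FFNN^\sigma_{H,K}(R)$ for any $K\ge K_0$ and $R\ge R_0$. If moreover $g$ depends on the labels, there exist $R_0'$ and $K_0'$ such that for all $K\ge K_0'$ and $R\ge R_0'$, $\mathcal A$ is not valid on $FFNN^\sigma_{H,K}(R)$, whichever exact training algorithm is used. -/

import Mathlib

open MeasureTheory ProbabilityTheory Filter Topology Set

/-! ### Data, losses and generating processes for binary classification -/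

/-- An input/output pair `z = (x, y)`, with input `x ∈ ℝ^d` and label `y ∈ ℝ`. -/
abbrev DataPoint (d : ℕ) : Type := EuclideanSpace ℝ (Fin d) × ℝ

/-- The data space `X × {0, 1}` of a binary classification problem with input space `X`. -/
def dataSpace {d : ℕ} (X : Set (EuclideanSpace ℝ (Fin d))) : Set (DataPoint d) :=
  X ×ˢ ({0, 1} : Set ℝ)

/-- The Lebesgue measure on the data space `X × {0, 1}`: Lebesgue measure on `X` times
the counting measure of the two labels. -/
noncomputable def dataLebesgue {d : ℕ} (X : Set (EuclideanSpace ℝ (Fin d))) :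
    Measure (DataPoint d) :=
  ((volume : Measure (EuclideanSpace ℝ (Fin d))).restrict X).prod
    (Measure.dirac (0 : ℝ) + Measure.dirac (1 : ℝ))

/-- Assumption (i): on `[0,1] × [0,1]` the loss is nonnegative and vanishes exactly on the
diagonal. -/
def LossSeparates (loss : ℝ → ℝ → ℝ) : Prop :=
  ∀ y ∈ Icc (0 : ℝ) 1, ∀ y' ∈ Icc (0 : ℝ) 1, 0 ≤ loss y y' ∧ (loss y y' = 0 ↔ y = y')

/-- Assumption (ii): for `q ∈ [0,1]` the function `y ↦ q ℓ(y,1) + (1-q) ℓ(y,0)` has a unique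
minimizer `y*_q` on `[0,1]`, and `y*_q` is (strictly) increasing in `q`. -/
def LossHasIncreasingMinimizer (loss : ℝ → ℝ → ℝ) : Prop :=
  ∃ ystar : ℝ → ℝ, StrictMonoOn ystar (Icc 0 1) ∧
    ∀ q ∈ Icc (0 : ℝ) 1, ystar q ∈ Icc (0 : ℝ) 1 ∧
      ∀ y ∈ Icc (0 : ℝ) 1, y ≠ ystar q →
        q * loss (ystar q) 1 + (1 - q) * loss (ystar q) 0 < q * loss y 1 + (1 - q) * loss y 0

/-- `μ` is a generating process for binary classification on `X`: a probability measure carried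
by `X × {0,1}`, whose input marginal is absolutely continuous with respect to the Lebesgue measure
on `X`, and for which `p` is an upper semicontinuous version of `x ↦ ℙ(Y = 1 | X = x)`. -/
structure IsBinaryProcess {d : ℕ} (X : Set (EuclideanSpace ℝ (Fin d)))
    (μ : Measure (DataPoint d)) (p : EuclideanSpace ℝ (Fin d) → ℝ) : Prop where
  isProb : IsProbabilityMeasure μ
  carried : μ (dataSpace X)ᶜ = 0
  marginal_ac : μ.map Prod.fst ≪ (volume : Measure (EuclideanSpace ℝ (Fin d))).restrict X
  p_mem : ∀ x ∈ X, p x ∈ Icc (0 : ℝ) 1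
  p_usc : UpperSemicontinuousOn p X
  p_cond : ∀ S : Set (EuclideanSpace ℝ (Fin d)), MeasurableSet S →
    μ (S ×ˢ ({1} : Set ℝ)) = ∫⁻ x in S, ENNReal.ofReal (p x) ∂(μ.map Prod.fst)

/-! ### Score-based pruning algorithms -/

/-- The `k`-th order statistic (`k ≥ 1`) of the scores `(g z)_{z ∈ Z}`, the first one being the
smallest score. -/
noncomputable def orderStat {d : ℕ} (g : DataPoint d → ℝ) (Z : Finset (DataPoint d)) (k : ℕ) : ℝ :=
  ((Z.val.map g).sort (· ≤ ·)).getD (k - 1) 0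

open Classical in
/-- `A` is a score-based pruning algorithm on the data space `D` with score function `g`: for a
finite data set `Z ⊆ D` and a compression level `r ∈ (0,1]`, it returns a subset of `Z`, and this
subset consists of the points whose score is at most the `⌊r|Z|⌋`-th order statistic of the scores.
The formula is only required on data sets without ties between scores; there it keeps exactly
`⌊r|Z|⌋` points, and how ties are treated is left free. -/
def IsSBPA {d : ℕ} (D : Set (DataPoint d)) (g : DataPoint d → ℝ)
    (A : Finset (DataPoint d) → ℝ → Finset (DataPoint d)) : Prop :=
  ∀ Z : Finset (DataPoint d), (Z : Set (DataPoint d)) ⊆ D → ∀ r ∈ Ioc (0 : ℝ) 1,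
    A Z r ⊆ Z ∧
    (1 ≤ ⌊r * (Z.card : ℝ)⌋₊ → InjOn g (Z : Set (DataPoint d)) →
      A Z r = Z.filter (fun z => g z ≤ orderStat g Z ⌊r * (Z.card : ℝ)⌋₊))

/-- `g` is an adapted score function: it is continuous on the data space, and its level sets
there are Lebesgue-null. -/
def IsAdapted {d : ℕ} (X : Set (EuclideanSpace ℝ (Fin d))) (g : DataPoint d → ℝ) : Prop :=
  ContinuousOn g (dataSpace X) ∧
    ∀ c ∈ g '' dataSpace X, dataLebesgue X (dataSpace X ∩ g ⁻¹' {c}) = 0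

/-- The score function `g` depends on the labels: at some input `x` in the support of the input
distribution, the two labels get different scores and both labels can happen, that is,
`ℙ(Y = 1 | X = x) ∈ (0,1)` and both `(x,0)` and `(x,1)` lie in the support of `μ`. -/
def DependsOnLabels {d : ℕ} (μ : Measure (DataPoint d)) (p : EuclideanSpace ℝ (Fin d) → ℝ)
    (g : DataPoint d → ℝ) : Prop :=
  ∃ x ∈ (μ.map Prod.fst).support, g (x, 0) ≠ g (x, 1) ∧ p x ∈ Ioo (0 : ℝ) 1 ∧
    (x, (0 : ℝ)) ∈ μ.support ∧ (x, (1 : ℝ)) ∈ μ.support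

/-! ### Learning with data pruning

A family of models is given by a parameter type `Θ`, a parameter space `W ⊆ Θ` and the outputs
`yout w x`. -/

/-- The generalization error of the parameter `w`. -/
noncomputable def genLoss {d : ℕ} {Θ : Type*} (loss : ℝ → ℝ → ℝ)
    (yout : Θ → EuclideanSpace ℝ (Fin d) → ℝ) (μ : Measure (DataPoint d)) (w : Θ) : ℝ :=
  ∫ z, loss (yout w z.1) z.2 ∂μ

/-- The average loss of the parameter `w` on a finite data set. -/
noncomputable def avgLoss {d : ℕ} {Θ : Type*} (loss : ℝ → ℝ → ℝ)
    (yout : Θ → EuclideanSpace ℝ (Fin d) → ℝ) (Z : Finset (DataPoint d)) (w : Θ) : ℝ :=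
  (1 / (Z.card : ℝ)) * ∑ z ∈ Z, loss (yout w z.1) z.2

/-- `Z 0, Z 1, …` are independent random data points with law `μ`. -/
structure IsIIDSample {d : ℕ} {Ω : Type*} [MeasurableSpace Ω] (P : Measure Ω)
    (Z : ℕ → Ω → DataPoint d) (μ : Measure (DataPoint d)) : Prop where
  meas : ∀ i, Measurable (Z i)
  indep : iIndepFun Z P
  law : ∀ i, P.map (Z i) = μ

open Classical in
/-- The data set formed by the first `n` sampled points. -/
noncomputable def dataset {d : ℕ} {Ω : Type*} (Z : ℕ → Ω → DataPoint d) (n : ℕ) (ω : Ω) :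
    Finset (DataPoint d) :=
  (Finset.range n).image (fun i => Z i ω)

/-- The empirical loss on the data kept by the pruning algorithm `A` at compression level `r`
out of the first `n` sampled points. -/
noncomputable def prunedLoss {d : ℕ} {Θ Ω : Type*} (loss : ℝ → ℝ → ℝ)
    (yout : Θ → EuclideanSpace ℝ (Fin d) → ℝ)
    (A : Finset (DataPoint d) → ℝ → Finset (DataPoint d)) (Z : ℕ → Ω → DataPoint d)
    (r : ℝ) (n : ℕ) (ω : Ω) (w : Θ) : ℝ :=
  avgLoss loss yout (A (dataset Z n ω) r) w

/-- The pruning algorithm is consistent on the parameter space `W`: at every compression level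
`r ∈ (0,1]` and for every `w ∈ W`, the pruned loss at `w` converges almost surely to the
generalization error of `w`. -/
def IsConsistent {d : ℕ} {Θ Ω : Type*} [MeasurableSpace Ω] (P : Measure Ω)
    (Z : ℕ → Ω → DataPoint d) (μ : Measure (DataPoint d)) (loss : ℝ → ℝ → ℝ)
    (A : Finset (DataPoint d) → ℝ → Finset (DataPoint d))
    (yout : Θ → EuclideanSpace ℝ (Fin d) → ℝ) (W : Set Θ) : Prop :=
  ∀ r ∈ Ioc (0 : ℝ) 1, ∀ w ∈ W, ∀ᵐ ω ∂P,
    Tendsto (fun n => prunedLoss loss yout A Z r n ω w) atTop (𝓝 (genLoss loss yout μ w))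

/-- `train r n ω` is the parameter found by an exact training algorithm on the pruned data: almost
surely, for all `n`, it minimizes the pruned loss over `W`. -/
def IsExactTraining {d : ℕ} {Θ Ω : Type*} [MeasurableSpace Ω] (P : Measure Ω)
    (Z : ℕ → Ω → DataPoint d) (loss : ℝ → ℝ → ℝ)
    (A : Finset (DataPoint d) → ℝ → Finset (DataPoint d))
    (yout : Θ → EuclideanSpace ℝ (Fin d) → ℝ) (W : Set Θ) (train : ℝ → ℕ → Ω → Θ) : Prop :=
  ∀ r ∈ Ioc (0 : ℝ) 1, ∀ᵐ ω ∂P, ∀ n, train r n ω ∈ W ∧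
    ∀ w ∈ W, prunedLoss loss yout A Z r n ω (train r n ω) ≤ prunedLoss loss yout A Z r n ω w

/-- The excess risk of the parameter `w` over the parameter space `W`. -/
noncomputable def riskGap {d : ℕ} {Θ : Type*} (loss : ℝ → ℝ → ℝ)
    (yout : Θ → EuclideanSpace ℝ (Fin d) → ℝ) (μ : Measure (DataPoint d)) (W : Set Θ)
    (w : Θ) : ℝ :=
  genLoss loss yout μ w - sInf (genLoss loss yout μ '' W)

/-- The pruning procedure is valid: at every compression level `r ∈ (0,1]`, the excess risk of the
trained parameters converges to `0` almost surely. -/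
def IsValid {d : ℕ} {Θ Ω : Type*} [MeasurableSpace Ω] (P : Measure Ω)
    (μ : Measure (DataPoint d)) (loss : ℝ → ℝ → ℝ)
    (yout : Θ → EuclideanSpace ℝ (Fin d) → ℝ) (W : Set Θ) (train : ℝ → ℕ → Ω → Θ) : Prop :=
  ∀ r ∈ Ioc (0 : ℝ) 1, ∀ᵐ ω ∂P,
    Tendsto (fun n => riskGap loss yout μ W (train r n ω)) atTop (𝓝 0)

/-! ### Fully-connected feed-forward neural networks -/

/-- One fully-connected layer `h ↦ σ(M h + b)`, with `σ` applied entrywise. -/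
def denseLayer {m n : ℕ} (σ : ℝ → ℝ) (M : Fin m → Fin n → ℝ) (b : Fin m → ℝ)
    (h : Fin n → ℝ) : Fin m → ℝ :=
  fun i => σ (∑ j, M i j * h j + b i)

/-- The composition of `L` layers of width `K`; the layer with index `0` acts first. -/
def layerStack {K : ℕ} (σ : ℝ → ℝ) : (L : ℕ) → (Fin L → Fin K → Fin K → ℝ) →
    (Fin L → Fin K → ℝ) → (Fin K → ℝ) → (Fin K → ℝ)
  | 0, _, _, h => h
  | L + 1, M, b, h =>
      layerStack σ L (fun l => M l.succ) (fun l => b l.succ) (denseLayer σ (M 0) (b 0) h)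

/-- The weights and biases of a network with inputs in `ℝ^d`, `H ≥ 1` hidden layers of `K` neurons
and a scalar output: weights and biases of the first hidden layer, of the `H - 1` further hidden
layers, and of the affine output layer. -/
abbrev FFNNParam (d H K : ℕ) : Type :=
  ((Fin K → Fin d → ℝ) × (Fin K → ℝ)) ×
  ((Fin (H - 1) → Fin K → Fin K → ℝ) × (Fin (H - 1) → Fin K → ℝ)) ×
  ((Fin K → ℝ) × ℝ)

namespace FFNNParam

variable {d H K : ℕ}

/-- Weights of the first hidden layer. -/
def inW (w : FFNNParam d H K) : Fin K → Fin d → ℝ := w.1.1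
/-- Biases of the first hidden layer. -/
def inB (w : FFNNParam d H K) : Fin K → ℝ := w.1.2
/-- Weights of the further hidden layers. -/
def hidW (w : FFNNParam d H K) : Fin (H - 1) → Fin K → Fin K → ℝ := w.2.1.1
/-- Biases of the further hidden layers. -/
def hidB (w : FFNNParam d H K) : Fin (H - 1) → Fin K → ℝ := w.2.1.2
/-- Weights of the output layer. -/
def outW (w : FFNNParam d H K) : Fin K → ℝ := w.2.2.1
/-- Bias of the output layer. -/
def outB (w : FFNNParam d H K) : ℝ := w.2.2.2

/-- All weights and biases lie in `[-R, R]`. -/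
def Bounded (R : ℝ) (w : FFNNParam d H K) : Prop :=
  (∀ i j, inW w i j ∈ Icc (-R) R) ∧ (∀ i, inB w i ∈ Icc (-R) R) ∧
  (∀ l i j, hidW w l i j ∈ Icc (-R) R) ∧ (∀ l i, hidB w l i ∈ Icc (-R) R) ∧
  (∀ i, outW w i ∈ Icc (-R) R) ∧ outB w ∈ Icc (-R) R

end FFNNParam

/-- The prediction at `x` of the network with parameters `w`, hidden activation `σ` and output
map `ρ` (`ρ = id` for a plain affine output layer). -/
def ffnnOut {d H K : ℕ} (σ ρ : ℝ → ℝ) (w : FFNNParam d H K) (x : EuclideanSpace ℝ (Fin d)) : ℝ :=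
  ρ (∑ i, FFNNParam.outW w i *
      layerStack σ (H - 1) (FFNNParam.hidW w) (FFNNParam.hidB w)
        (denseLayer σ (FFNNParam.inW w) (FFNNParam.inB w) (fun j => x j)) i
    + FFNNParam.outB w)

/-- The parameter space of `FFNN_{H,K}(R)`: all weights and biases lie in `[-R, R]`, and the network
is a model from `X` to the prediction space `[0,1]`. -/
def FFNN {d : ℕ} (X : Set (EuclideanSpace ℝ (Fin d))) (σ ρ : ℝ → ℝ) (H K : ℕ) (R : ℝ) :
    Set (FFNNParam d H K) :=
  {w | FFNNParam.Bounded R w ∧ ∀ x ∈ X, ffnnOut σ ρ w x ∈ Icc (0 : ℝ) 1}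

/-- Admissible output maps: continuous, nondecreasing, and with `[0,1]` in the closure of the range.
Examples are the identity, the truncation to `[0,1]` and the logistic function. -/
structure IsOutputMap (ρ : ℝ → ℝ) : Prop where
  cont : Continuous ρ
  mono : Monotone ρ
  dense : Icc (0 : ℝ) 1 ⊆ closure (range ρ)

/-!
Asymptotically, pruning at level `r` with score `g` replaces the data distribution `μ` by its
restriction to a sublevel set `S = {g ≤ c}` of probability `r`, normalized. An adapted score has no
atoms under `μ`, so the sampled scores are almost surely distinct and the pruned set is a sublevel
set of the sample with exactly `⌊r n⌋` points. The sample points in `S` form another sublevel set,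
with `r n + o(n)` points by the law of large numbers. Sublevel sets are nested, so the two differ by
`o(n)` points, and averages over them have the same limits. By separability of the continuous
functions on the compact data space, almost surely this holds for all continuous functions at once
(`IsIIDSample.ae_tendsto_pruned_average`); no convergence of empirical quantiles is needed.

*Inconsistency.* Consistency would force `μ` restricted to `S` and `r • μ` to give the same risk to
every network. With `0 < r < 1` these measures differ, and a predictor with two values already
distinguishes their risks: otherwise a convex combination of `ℓ · 1` and `ℓ · 0` would be constant
on `[0,1]`, against the uniqueness of its minimizer (`exists_risk_restrict_ne`). A fixed network
approximates this predictor, and it embeds into all wider families with larger weights.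

*Invalidity.* The parameter space is compact, and a cluster point of the trained parameters is a
minimizer of the risk restricted to `S`; if training is valid, it also minimizes the risk
under `μ` (`IsValid.exists_common_minimizer`). If `g` depends on the labels, some `S` keeps only one
label on an open set on which both labels can happen; upper semicontinuity of `p` ensures that
`0 < p < 1` with positive probability there. Being nearly optimal for the restriction to `S` then
forces predictions close to that label, being nearly optimal for `μ` forces predictions close to
`y*_{p(x)}`, and these differ by strict monotonicity (`exists_no_common_near_minimizer`). Wide
networks reach the infimum of either risk over all measurable predictors up to any `ε`, which
gives the contradiction.

*Universal approximation.* For one hidden layer, let `V` be the closed span of the neurons. It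
contains the neurons whose activation is a mollification of `σ`, and then, by differentiating in
the weights, all products of `k` linear forms, provided that the `k`-th derivative of some
mollification does not vanish identically. If it did for all mollifications, these would be
polynomials of degree less than `k`, and so would be their pointwise limit `σ`. Hence `V` contains
all polynomials and is dense (`ridgeSpan_eq_top`). Further layers can imitate the identity near a
point where `σ` has a nonzero derivative (`exists_layerStack_approx`), and the output map `ρ` has
continuous approximate right inverses (`IsOutputMap.exists_approx_inverse`).
-/

/-! ### Density of ridge functions -/

theorem Submodule.integral_mem {α E : Type*} [MeasurableSpace α] {m : Measure α}
    [NormedAddCommGroup E] [NormedSpace ℝ E] [CompleteSpace E] (V : Submodule ℝ E)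
    (hV : IsClosed (V : Set E)) {F : α → E} (hF : Integrable F m) (hmem : ∀ s, F s ∈ V) :
    ∫ s, F s ∂m ∈ V := by
  have : IsClosed (V : Set E) := hV
  have hq := ContinuousLinearMap.integral_comp_comm V.mkQL hF
  have h0 : ∀ s, V.mkQL (F s) = 0 := fun s => (Submodule.Quotient.mk_eq_zero _).2 (hmem s)
  simp only [h0, integral_zero] at hq
  exact (Submodule.Quotient.mk_eq_zero _).1 hq.symm

section Ridge

variable {T ι : Type*} [TopologicalSpace T] [CompactSpace T] [Fintype ι]

/-- The linear form `t ↦ ∑ j, w j * τ j t` in the coordinates `τ` of a space `T`. -/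
noncomputable def linForm (τ : ι → C(T, ℝ)) (w : ι → ℝ) : C(T, ℝ) := ∑ j, w j • τ j

/-- The ridge function `t ↦ f (∑ j, w j * τ j t + b)`: one neuron with activation `f`. -/
noncomputable def ridge (τ : ι → C(T, ℝ)) (f : C(ℝ, ℝ)) (w : ι → ℝ) (b : ℝ) : C(T, ℝ) :=
  f.comp (linForm τ w + ContinuousMap.const T b)

/-- The closed linear span of the neurons with activation `σ`. -/
noncomputable def ridgeSpan (τ : ι → C(T, ℝ)) (σ : C(ℝ, ℝ)) : Submodule ℝ C(T, ℝ) :=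
  (Submodule.span ℝ (range fun q : (ι → ℝ) × ℝ => ridge τ σ q.1 q.2)).topologicalClosure

omit [CompactSpace T] in
theorem linForm_apply (τ : ι → C(T, ℝ)) (w : ι → ℝ) (t : T) :
    linForm τ w t = ∑ j, w j * τ j t := by
  simp [linForm, ContinuousMap.sum_apply]

omit [CompactSpace T] in
theorem ridge_apply (τ : ι → C(T, ℝ)) (f : C(ℝ, ℝ)) (w : ι → ℝ) (b : ℝ) (t : T) :
    ridge τ f w b t = f (linForm τ w t + b) := rfl

theorem isClosed_ridgeSpan (τ : ι → C(T, ℝ)) (σ : C(ℝ, ℝ)) :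
    IsClosed (ridgeSpan τ σ : Set C(T, ℝ)) :=
  Submodule.isClosed_topologicalClosure _

theorem ridge_mem_ridgeSpan (τ : ι → C(T, ℝ)) (σ : C(ℝ, ℝ)) (w : ι → ℝ) (b : ℝ) :
    ridge τ σ w b ∈ ridgeSpan τ σ :=
  Submodule.le_topologicalClosure _ (Submodule.subset_span ⟨(w, b), rfl⟩)

theorem ContDiffBump.contDiff_convolution (φ : ContDiffBump (0 : ℝ)) (σ : C(ℝ, ℝ)) (n : ℕ∞) :
    ContDiff ℝ n (convolution (φ.normed volume) σ (ContinuousLinearMap.lsmul ℝ ℝ) volume) :=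
  φ.hasCompactSupport_normed.contDiff_convolution_left _ φ.contDiff_normed
    σ.continuous.locallyIntegrable

/-- A neuron with mollified activation is an average of neurons with shifted biases. -/
theorem ridge_convolution_mem (τ : ι → C(T, ℝ)) (σ : C(ℝ, ℝ)) (φ : ContDiffBump (0 : ℝ))
    (f : C(ℝ, ℝ))
    (hf : ⇑f = convolution (φ.normed volume) σ (ContinuousLinearMap.lsmul ℝ ℝ) volume)
    (w : ι → ℝ) (b : ℝ) : ridge τ f w b ∈ ridgeSpan τ σ := by
  let F : ℝ → C(T, ℝ) := fun s => φ.normed volume s • ridge τ σ w (b - s)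
  have hR : Continuous fun s : ℝ => ridge τ σ w (b - s) := by
    let G : C(ℝ × T, ℝ) := ⟨fun q => σ (linForm τ w q.2 + (b - q.1)), by fun_prop⟩
    exact G.curry.continuous
  have hF : Continuous F := φ.continuous_normed.smul hR
  have hFc : HasCompactSupport F := φ.hasCompactSupport_normed.smul_right
  have hFi : Integrable F := hF.integrable_of_hasCompactSupport hFc
  have hmem : ∀ s, F s ∈ ridgeSpan τ σ := fun s =>
    Submodule.smul_mem _ _ (ridge_mem_ridgeSpan τ σ w _)
  have hint : ∫ s, F s = ridge τ f w b := by
    ext t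
    rw [ridge_apply, hf, convolution_def,
      show (∫ s, F s) t = ContinuousMap.evalCLM ℝ t (∫ s, F s) from rfl,
      ← ContinuousLinearMap.integral_comp_comm _ hFi]
    refine integral_congr_ae (Eventually.of_forall fun s => ?_)
    simp [F, ridge_apply, add_sub_assoc]
  rw [← hint]
  exact Submodule.integral_mem _ (isClosed_ridgeSpan τ σ) hFi hmem

/-- Differentiating a neuron in its input weights, in the direction `v`, stays in any closed
subspace that contains all these neurons. -/
theorem mul_ridge_deriv_mem (τ : ι → C(T, ℝ)) (V : Submodule ℝ C(T, ℝ))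
    (hV : IsClosed (V : Set C(T, ℝ))) (u : C(T, ℝ)) (f f' : C(ℝ, ℝ))
    (hf : ∀ s, HasDerivAt f (f' s) s) (h : ∀ w b, u * ridge τ f w b ∈ V) (v w : ι → ℝ) (b : ℝ) :
    u * linForm τ v * ridge τ f' w b ∈ V := by
  -- The difference quotients, written as integrals so that they extend continuously to `0`.
  let G : C(ℝ × T, ℝ) := ⟨fun q => u q.2 * linForm τ v q.2 *
      ∫ s in (0 : ℝ)..1, f' (linForm τ w q.2 + b + s * (q.1 * linForm τ v q.2)), by
    refine Continuous.mul (by fun_prop) ?_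
    refine intervalIntegral.continuous_parametric_intervalIntegral_of_continuous ?_
      continuous_const
    exact f'.continuous.comp (by fun_prop)⟩
  have hG0 : G.curry 0 = u * linForm τ v * ridge τ f' w b := by
    ext t
    simp [G, ridge_apply]
  have hGmem : ∀ δ : ℝ, δ ≠ 0 → G.curry δ ∈ V := by
    intro δ hδ
    have : G.curry δ = δ⁻¹ • (u * ridge τ f (w + δ • v) b - u * ridge τ f w b) := by
      ext t
      have hadd : linForm τ (w + δ • v) t = linForm τ w t + δ * linForm τ v t := by
        simp only [linForm_apply, Finset.mul_sum, ← Finset.sum_add_distrib]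
        exact Finset.sum_congr rfl fun j _ => by simp; ring
      have hint : (δ * linForm τ v t) *
          ∫ s in (0 : ℝ)..1, f' (linForm τ w t + b + s * (δ * linForm τ v t)) =
          f (linForm τ w t + b + δ * linForm τ v t) - f (linForm τ w t + b) := by
        rw [← intervalIntegral.integral_const_mul]
        have hd : ∀ s ∈ uIcc (0 : ℝ) 1, HasDerivAt
            (fun s => f (linForm τ w t + b + s * (δ * linForm τ v t)))
            (δ * linForm τ v t * f' (linForm τ w t + b + s * (δ * linForm τ v t))) s := by
          intro s _
          have h1 : HasDerivAt (fun s : ℝ => linForm τ w t + b + s * (δ * linForm τ v t))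
              (δ * linForm τ v t) s := by
            simpa using ((hasDerivAt_id s).mul_const (δ * linForm τ v t)).const_add
              (linForm τ w t + b)
          exact ((hf _).comp s h1).congr_deriv (mul_comm _ _)
        rw [intervalIntegral.integral_eq_sub_of_hasDerivAt hd
          (Continuous.intervalIntegrable (by fun_prop) _ _)]
        simp
      simp only [ContinuousMap.curry_apply, ContinuousMap.smul_apply, ContinuousMap.sub_apply,
        ContinuousMap.mul_apply, ridge_apply, hadd, smul_eq_mul]
      rw [show linForm τ w t + δ * linForm τ v t + b =
        linForm τ w t + b + δ * linForm τ v t by ring, ← mul_sub, ← hint]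
      simp only [G, ContinuousMap.coe_mk]
      generalize (∫ s in (0 : ℝ)..1, f' (linForm τ w t + b + s * (δ * linForm τ v t))) = I
      field_simp
    rw [this]
    exact V.smul_mem _ (V.sub_mem (h _ _) (h _ _))
  rw [← hG0]
  have hlim : Tendsto G.curry (𝓝[≠] (0 : ℝ)) (𝓝 (G.curry 0)) :=
    (G.curry.continuous.tendsto 0).mono_left nhdsWithin_le_nhds
  exact hV.mem_of_tendsto hlim (eventually_nhdsWithin_of_forall fun δ hδ => hGmem δ hδ)

theorem prod_linForm_mul_ridge_iteratedDeriv_mem (τ : ι → C(T, ℝ)) (V : Submodule ℝ C(T, ℝ))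
    (hV : IsClosed (V : Set C(T, ℝ))) (f : C(ℝ, ℝ)) (hf : ContDiff ℝ (⊤ : ℕ∞) f)
    (h : ∀ w b, ridge τ f w b ∈ V) (l : List (ι → ℝ)) (w : ι → ℝ) (b : ℝ) :
    (l.map (linForm τ)).prod *
      ridge τ ⟨iteratedDeriv l.length f, hf.continuous_iteratedDeriv _ (by exact_mod_cast le_top)⟩
        w b ∈ V := by
  induction l generalizing w b with
  | nil =>
    convert h w b using 1
    ext t
    simp [ridge_apply]
  | cons v l ih =>
    have := mul_ridge_deriv_mem τ V hV (l.map (linForm τ)).prod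
      ⟨iteratedDeriv l.length f, hf.continuous_iteratedDeriv _ (by exact_mod_cast le_top)⟩
      ⟨iteratedDeriv (l.length + 1) f, hf.continuous_iteratedDeriv _ (by exact_mod_cast le_top)⟩
      (fun s => by
        simp only [ContinuousMap.coe_mk, iteratedDeriv_succ]
        exact ((hf.differentiable_iteratedDeriv l.length
          (by exact_mod_cast WithTop.coe_lt_top _)) s).hasDerivAt) ih v w b
    simpa [mul_comm, mul_left_comm, mul_assoc] using this

/-- Pointwise limits of polynomials of bounded degree are polynomials: interpolate at finitely
many nodes. -/
theorem exists_polynomial_of_tendsto {σ : ℝ → ℝ} (k : ℕ) (q : ℕ → Polynomial ℝ)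
    (hq : ∀ n, (q n).degree < k) (h : ∀ t, Tendsto (fun n => (q n).eval t) atTop (𝓝 (σ t))) :
    ∃ r : Polynomial ℝ, ∀ t, σ t = r.eval t := by
  let node : ℕ → ℝ := fun i => i
  have hinj : InjOn node (Finset.range k : Set ℕ) := fun i _ j _ hij => by
    simpa [node] using hij
  refine ⟨Lagrange.interpolate (Finset.range k) node (fun i => σ (node i)), fun t => ?_⟩
  refine tendsto_nhds_unique (h t) ?_
  have : ∀ n, (q n).eval t =
      ∑ i ∈ Finset.range k,
        (q n).eval (node i) * (Lagrange.basis (Finset.range k) node i).eval t := by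
    intro n
    conv_lhs => rw [Lagrange.eq_interpolate (f := q n) hinj (by simpa using hq n)]
    simp [Lagrange.interpolate_apply, Polynomial.eval_finsetSum]
  simp only [this, Lagrange.interpolate_apply, Polynomial.eval_finsetSum, Polynomial.eval_mul,
    Polynomial.eval_C]
  exact tendsto_finsetSum _ fun i _ => (h _).mul_const _

/-- A function whose `k`-th derivative vanishes is a polynomial of degree less than `k`. -/
theorem exists_polynomial_of_iteratedDeriv_eq_zero (k : ℕ) (f : ℝ → ℝ)
    (hf : ContDiff ℝ (⊤ : ℕ∞) f) (h : ∀ t, iteratedDeriv k f t = 0) :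
    ∃ q : Polynomial ℝ, q.degree < k ∧ ∀ t, f t = q.eval t := by
  induction k generalizing f with
  | zero => exact ⟨0, by simp, fun t => by simpa using h t⟩
  | succ k ih =>
    have hd : ContDiff ℝ (⊤ : ℕ∞) (deriv f) := by
      have : ContDiff ℝ ((⊤ : ℕ∞) + 1 : WithTop ℕ∞) f := by simpa using hf
      exact (contDiff_succ_iff_deriv.1 this).2.2
    obtain ⟨q, hq, hq'⟩ := ih (deriv f) hd fun t => by rw [← iteratedDeriv_succ']; exact h t
    let r : Polynomial ℝ := ∑ i ∈ Finset.range k,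
      Polynomial.C (q.coeff i / (i + 1)) * Polynomial.X ^ (i + 1)
    have hr : ∀ t, HasDerivAt (fun s => f s - r.eval s) 0 t := by
      intro t
      have h1 := ((hf.differentiable (by simp)) t).hasDerivAt.sub (r.hasDerivAt t)
      refine h1.congr_deriv ?_
      have hrd : r.derivative = q := by
        have hsum : q = ∑ i ∈ Finset.range k, Polynomial.C (q.coeff i) * Polynomial.X ^ i := by
          ext n
          simp only [Polynomial.finsetSum_coeff, Polynomial.coeff_C_mul_X_pow,
            Finset.sum_ite_eq, Finset.mem_range]
          split_ifs with hn
          · rfl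
          · exact Polynomial.coeff_eq_zero_of_degree_lt
              (hq.trans_le (by exact_mod_cast not_lt.1 hn))
        conv_rhs => rw [hsum]
        simp only [r, Polynomial.derivative_sum, Polynomial.derivative_C_mul_X_pow]
        refine Finset.sum_congr rfl fun i _ => ?_
        rw [Nat.cast_add_one, div_mul_cancel₀ _ (by positivity), Nat.add_sub_cancel]
      rw [hrd, hq' t, sub_self]
    refine ⟨r + Polynomial.C (f 0 - r.eval 0), ?_, fun t => ?_⟩
    · rw [← Polynomial.mem_degreeLT]
      refine add_mem (sum_mem fun i hi => ?_) ?_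
      · rw [Polynomial.mem_degreeLT]
        refine (Polynomial.degree_C_mul_X_pow_le _ _).trans_lt ?_
        have := Finset.mem_range.1 hi
        exact_mod_cast (by omega : i + 1 < k + 1)
      · rw [Polynomial.mem_degreeLT]
        exact Polynomial.degree_C_le.trans_lt (by exact_mod_cast Nat.succ_pos k)
    · have := is_const_of_deriv_eq_zero (fun t => (hr t).differentiableAt)
        (fun t => (hr t).deriv) t 0
      simp only [Polynomial.eval_add, Polynomial.eval_C]
      linarith

/-- For a continuous activation that is not a polynomial, every product of linear forms lies in the
closed span of the neurons: some mollification of `σ` has a nonzero derivative of the order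
needed. -/
theorem prod_linForm_mem_ridgeSpan (τ : ι → C(T, ℝ)) (σ : C(ℝ, ℝ))
    (hσ : ¬ ∃ q : Polynomial ℝ, ∀ t, σ t = q.eval t) (l : List (ι → ℝ)) :
    (l.map (linForm τ)).prod ∈ ridgeSpan τ σ := by
  let φ : ℕ → ContDiffBump (0 : ℝ) := fun n =>
    ⟨1 / (2 * (n + 1)), 1 / (n + 1), by positivity, by
      rw [div_lt_div_iff_of_pos_left one_pos (by positivity) (by positivity)]
      linarith [(by positivity : (0 : ℝ) ≤ n)]⟩
  let f : ℕ → ℝ → ℝ := fun n =>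
    convolution ((φ n).normed volume) σ (ContinuousLinearMap.lsmul ℝ ℝ) volume
  have hf : ∀ n, ContDiff ℝ (⊤ : ℕ∞) (f n) := fun n => (φ n).contDiff_convolution σ ⊤
  obtain ⟨n, b, hb⟩ : ∃ n b, iteratedDeriv l.length (f n) b ≠ 0 := by
    by_contra! hcon
    choose q hq hq' using fun n =>
      exists_polynomial_of_iteratedDeriv_eq_zero l.length (f n) (hf n) (hcon n)
    refine hσ (exists_polynomial_of_tendsto l.length q hq fun t => ?_)
    simp only [← hq']
    exact ContDiffBump.convolution_tendsto_right_of_continuous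
      (by simpa [φ] using tendsto_one_div_add_atTop_nhds_zero_nat (𝕜 := ℝ)) σ.continuous t
  have hmem := prod_linForm_mul_ridge_iteratedDeriv_mem τ (ridgeSpan τ σ)
    (isClosed_ridgeSpan τ σ) ⟨f n, (hf n).continuous⟩ (hf n)
    (ridge_convolution_mem τ σ (φ n) ⟨f n, (hf n).continuous⟩ rfl) l 0 b
  have h2 := Submodule.smul_mem _ (iteratedDeriv l.length (f n) b)⁻¹ hmem
  convert h2 using 1
  ext t
  simp [ridge_apply, linForm_apply]
  field_simp

/-- **Universal approximation** for one hidden layer: the neurons with a continuous non-polynomial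
activation span a dense subspace of the continuous functions on a compact space whose points are
separated by the coordinates. -/
theorem ridgeSpan_eq_top (τ : ι → C(T, ℝ)) (hτ : ∀ s t, (∀ j, τ j s = τ j t) → s = t)
    (σ : C(ℝ, ℝ)) (hσ : ¬ ∃ q : Polynomial ℝ, ∀ t, σ t = q.eval t) :
    ridgeSpan τ σ = ⊤ := by
  classical
  let S : Subalgebra ℝ C(T, ℝ) := Algebra.adjoin ℝ (range (linForm τ))
  have hS : Subalgebra.toSubmodule S ≤ ridgeSpan τ σ := by
    rw [Algebra.adjoin_eq_span, Submodule.span_le]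
    intro u hu
    obtain ⟨l, hl, rfl⟩ := Submonoid.exists_list_of_mem_closure hu
    choose! v hv using hl
    have : l = (l.map v).map (linForm τ) := by
      rw [List.map_map]
      exact (List.map_id'' (fun _ => rfl) l).symm.trans
        (List.map_congr_left fun y hy => (hv y hy).symm)
    rw [this]
    exact prod_linForm_mem_ridgeSpan τ σ hσ _
  have hsep : S.SeparatesPoints := by
    intro s t hst
    obtain ⟨j, hj⟩ : ∃ j, τ j s ≠ τ j t := by
      by_contra! hcon
      exact hst (hτ s t hcon)
    refine ⟨_, ⟨linForm τ (Pi.single j 1), Algebra.subset_adjoin ⟨_, rfl⟩, rfl⟩, ?_⟩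
    simpa [linForm_apply, Pi.single_apply] using hj
  have htop := ContinuousMap.subalgebra_topologicalClosure_eq_top_of_separatesPoints S hsep
  rw [eq_top_iff]
  intro u _
  have hu : u ∈ closure (S : Set C(T, ℝ)) := by
    rw [← Subalgebra.topologicalClosure_coe, htop]
    trivial
  exact closure_minimal hS (isClosed_ridgeSpan τ σ) hu

/-- Uniform approximation by shallow networks. -/
theorem exists_shallow_approx (τ : ι → C(T, ℝ)) (hτ : ∀ s t, (∀ j, τ j s = τ j t) → s = t)
    (σ : C(ℝ, ℝ)) (hσ : ¬ ∃ q : Polynomial ℝ, ∀ t, σ t = q.eval t) (u : C(T, ℝ)) {ε : ℝ}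
    (hε : 0 < ε) :
    ∃ (K : ℕ) (c : Fin K → ℝ) (w : Fin K → ι → ℝ) (b : Fin K → ℝ),
      ∀ t, |∑ i, c i * σ (∑ j, w i j * τ j t + b i) - u t| < ε := by
  have hu : u ∈ ridgeSpan τ σ := by rw [ridgeSpan_eq_top τ hτ σ hσ]; trivial
  obtain ⟨v, hv, hvu⟩ := Metric.mem_closure_iff.1 hu ε hε
  obtain ⟨K, c, q, rfl⟩ := Submodule.mem_span_set'.1 hv
  choose a ha using fun i => (q i).2
  refine ⟨K, c, fun i => (a i).1, fun i => (a i).2, fun t => ?_⟩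
  have := (ContinuousMap.dist_lt_iff hε).1 hvu t
  rw [dist_comm, Real.dist_eq] at this
  convert this using 3
  rw [ContinuousMap.sum_apply]
  refine Finset.sum_congr rfl fun i _ => ?_
  rw [ContinuousMap.smul_apply, ← ha i, ridge_apply, linForm_apply, smul_eq_mul]

end Ridge

/-! ### Deep networks of bounded weights -/

/-- On bounded inputs, further layers can be made to act as the identity up to an affine change of
the output layer: feed `σ` with small multiples of its input around a point where it has a nonzero
derivative. -/
theorem exists_layerStack_approx {α : Type*} {K : ℕ} {σ : ℝ → ℝ} (hσ : Continuous σ) {a s : ℝ}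
    (hs : s ≠ 0) (hd : HasDerivAt σ s a) (L : ℕ) (h : α → Fin K → ℝ) {B : ℝ}
    (hB : ∀ x i, |h x i| ≤ B) (c : Fin K → ℝ) (c₀ : ℝ) {ε : ℝ} (hε : 0 < ε) :
    ∃ (M : Fin L → Fin K → Fin K → ℝ) (b : Fin L → Fin K → ℝ) (c' : Fin K → ℝ) (c₀' : ℝ),
      ∀ x, |(∑ i, c' i * layerStack σ L M b (h x) i + c₀') - (∑ i, c i * h x i + c₀)| < ε := by
  classical
  induction L generalizing h B c c₀ ε with
  | zero => exact ⟨Fin.elim0, Fin.elim0, c, c₀, fun x => by simpa [layerStack] using hε⟩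
  | succ L ih =>
    set C : ℝ := ∑ i, |c i| with hC
    have hC0 : 0 ≤ C := Finset.sum_nonneg fun i _ => abs_nonneg _
    have hs' : 0 < |s| := abs_pos.2 hs
    set η : ℝ := ε * |s| / (2 * (C + 1)) with hη
    have hη0 : 0 < η := by positivity
    set B' : ℝ := |B| + 1 with hB'
    have hB'0 : 0 < B' := by positivity
    have hBB' : ∀ x i, |h x i| ≤ B' := fun x i =>
      (hB x i).trans ((le_abs_self B).trans (by linarith))
    have hlittle := (hasDerivAt_iff_isLittleO_nhds_zero.1 hd).def (div_pos hη0 hB'0)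
    obtain ⟨r, hr0, hr⟩ := Metric.eventually_nhds_iff.1 hlittle
    set δ : ℝ := r / (2 * B') with hδ
    have hδ0 : 0 < δ := by positivity
    have hest : ∀ x i, |σ (a + δ * h x i) - σ a - δ * h x i * s| ≤ η * δ := by
      intro x i
      have habs : |δ * h x i| ≤ δ * B' := by
        rw [abs_mul, abs_of_pos hδ0]
        exact mul_le_mul_of_nonneg_left (hBB' x i) hδ0.le
      have hlt : dist (δ * h x i) 0 < r := by
        rw [Real.dist_eq, sub_zero]
        refine habs.trans_lt ?_
        rw [hδ]
        have : r / (2 * B') * B' = r / 2 := by field_simp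
        linarith
      have := hr hlt
      simp only [Real.norm_eq_abs, smul_eq_mul] at this
      refine this.trans ?_
      calc η / B' * |δ * h x i| ≤ η / B' * (δ * B') :=
            mul_le_mul_of_nonneg_left habs (by positivity)
        _ = η * δ := by field_simp
    let M₀ : Fin K → Fin K → ℝ := fun i j => if i = j then δ else 0
    let h' : α → Fin K → ℝ := fun x => denseLayer σ M₀ (fun _ => a) (h x)
    have hh' : ∀ x i, h' x i = σ (a + δ * h x i) := by
      intro x i
      simp [h', denseLayer, M₀, add_comm]
    obtain ⟨D, hD⟩ : ∃ D, ∀ x i, |h' x i| ≤ D := by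
      obtain ⟨D, hD⟩ := (isCompact_Icc (a := a - δ * B')
        (b := a + δ * B')).exists_bound_of_continuousOn hσ.continuousOn
      refine ⟨D, fun x i => ?_⟩
      rw [hh']
      refine hD _ ?_
      have := abs_le.1 (hBB' x i)
      constructor <;> nlinarith
    obtain ⟨M, b, c', c₀', hc'⟩ := ih h' hD (fun i => c i / (δ * s))
      (c₀ - ∑ i, c i / (δ * s) * σ a) (half_pos hε)
    refine ⟨Fin.cons M₀ M, Fin.cons (fun _ => a) b, c', c₀', fun x => ?_⟩
    have h1 := hc' x
    have h2 : |(∑ i, c i / (δ * s) * h' x i + (c₀ - ∑ i, c i / (δ * s) * σ a)) -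
        (∑ i, c i * h x i + c₀)| ≤ ε / 2 := by
      have : (∑ i, c i / (δ * s) * h' x i + (c₀ - ∑ i, c i / (δ * s) * σ a)) -
          (∑ i, c i * h x i + c₀) =
          ∑ i, c i / (δ * s) * (σ (a + δ * h x i) - σ a - δ * h x i * s) := by
        simp only [hh', mul_sub, Finset.sum_sub_distrib]
        have : ∀ i, c i / (δ * s) * (δ * h x i * s) = c i * h x i := fun i => by field_simp
        simp only [this]
        ring
      rw [this]
      calc _ ≤ ∑ i, |c i / (δ * s) * (σ (a + δ * h x i) - σ a - δ * h x i * s)| :=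
            Finset.abs_sum_le_sum_abs _ _
        _ ≤ ∑ i, |c i| * (η / |s|) := by
            refine Finset.sum_le_sum fun i _ => ?_
            rw [abs_mul, abs_div, abs_mul, abs_of_pos hδ0]
            calc |c i| / (δ * |s|) * |σ (a + δ * h x i) - σ a - δ * h x i * s|
                ≤ |c i| / (δ * |s|) * (η * δ) :=
                  mul_le_mul_of_nonneg_left (hest x i) (by positivity)
              _ = |c i| * (η / |s|) := by field_simp
        _ = C / (C + 1) * (ε / 2) := by
            rw [← Finset.sum_mul, ← hC, hη]
            field_simp
        _ ≤ 1 * (ε / 2) := by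
            refine mul_le_mul_of_nonneg_right ?_ (half_pos hε).le
            rw [div_le_one (by positivity)]
            linarith
        _ = ε / 2 := one_mul _
    have h3 : layerStack σ (L + 1) (Fin.cons M₀ M) (Fin.cons (fun _ => a) b) (h x) =
        layerStack σ L M b (h' x) := by
      simp [layerStack, h']
    rw [h3]
    calc _ ≤ _ := abs_sub_le _ (∑ i, c i / (δ * s) * h' x i + (c₀ - ∑ i, c i / (δ * s) * σ a)) _
      _ < ε / 2 + ε / 2 := add_lt_add_of_lt_of_le h1 h2
      _ = ε := add_halves ε

/-- Padding a stack of layers with neurons whose outgoing weights to the given neurons vanish. -/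
theorem layerStack_pad {K m : ℕ} (σ : ℝ → ℝ) (L : ℕ) (M : Fin L → Fin K → Fin K → ℝ)
    (b : Fin L → Fin K → ℝ) (h : Fin K → ℝ) (h' : Fin (K + m) → ℝ)
    (hh : ∀ i, h' (Fin.castAdd m i) = h i) (i : Fin K) :
    layerStack σ L (fun l => Fin.append (fun i => Fin.append (M l i) 0) 0)
      (fun l => Fin.append (b l) 0) h' (Fin.castAdd m i) = layerStack σ L M b h i := by
  induction L generalizing h h' with
  | zero => exact hh i
  | succ L ih =>
    simp only [layerStack]
    refine ih (fun l => M l.succ) (fun l => b l.succ) _ _ fun i => ?_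
    simp [denseLayer, Fin.sum_univ_add, Fin.append_left, Fin.append_right, hh]

theorem FFNNParam.exists_pad {d H K : ℕ} (σ ρ : ℝ → ℝ) (w : FFNNParam d H K) (m : ℕ) :
    ∃ w' : FFNNParam d H (K + m), (∀ R, 0 ≤ R → FFNNParam.Bounded R w → FFNNParam.Bounded R w') ∧
      ∀ x, ffnnOut σ ρ w' x = ffnnOut σ ρ w x := by
  refine ⟨⟨⟨Fin.append w.inW 0, Fin.append w.inB 0⟩,
    ⟨fun l => Fin.append (fun i => Fin.append (w.hidW l i) 0) 0, fun l => Fin.append (w.hidB l) 0⟩,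
    ⟨Fin.append w.outW 0, w.outB⟩⟩, ?_, ?_⟩
  · rintro R hR ⟨h1, h2, h3, h4, h5, h6⟩
    have h0 : (0 : ℝ) ∈ Icc (-R) R := ⟨by linarith, hR⟩
    refine ⟨fun i j => ?_, fun i => ?_, fun l i j => ?_, fun l i => ?_, fun i => ?_, h6⟩
    · refine Fin.addCases (fun i => ?_) (fun i => ?_) i
      · simpa [FFNNParam.inW] using h1 i j
      · simpa [FFNNParam.inW] using h0
    · refine Fin.addCases (fun i => ?_) (fun i => ?_) i
      · simpa [FFNNParam.inB] using h2 i
      · simpa [FFNNParam.inB] using h0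
    · refine Fin.addCases (fun i => ?_) (fun i => ?_) i
      · refine Fin.addCases (fun j => ?_) (fun j => ?_) j
        · simpa [FFNNParam.hidW] using h3 l i j
        · simpa [FFNNParam.hidW] using h0
      · simpa [FFNNParam.hidW] using h0
    · refine Fin.addCases (fun i => ?_) (fun i => ?_) i
      · simpa [FFNNParam.hidB] using h4 l i
      · simpa [FFNNParam.hidB] using h0
    · refine Fin.addCases (fun i => ?_) (fun i => ?_) i
      · simpa [FFNNParam.outW] using h5 i
      · simpa [FFNNParam.outW] using h0
  · intro x
    have key := layerStack_pad (m := m) σ (H - 1) w.hidW w.hidB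
      (denseLayer σ w.inW w.inB (fun j => x j))
      (denseLayer σ (Fin.append w.inW 0) (Fin.append w.inB 0) (fun j => x j))
      (fun i => by simp [denseLayer])
    simp only [ffnnOut, FFNNParam.inW, FFNNParam.inB, FFNNParam.hidW, FFNNParam.hidB,
      FFNNParam.outW, FFNNParam.outB] at key ⊢
    simp only [Fin.sum_univ_add, Fin.append_left, Fin.append_right, key]
    simp

theorem FFNNParam.bounded_norm {d H K : ℕ} (w : FFNNParam d H K) :
    FFNNParam.Bounded ‖w‖ w := by
  have p1 : ‖w.1‖ ≤ ‖w‖ := norm_fst_le w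
  have p2 : ‖w.2‖ ≤ ‖w‖ := norm_snd_le w
  have p11 : ‖w.1.1‖ ≤ ‖w‖ := (norm_fst_le w.1).trans p1
  have p12 : ‖w.1.2‖ ≤ ‖w‖ := (norm_snd_le w.1).trans p1
  have p21 : ‖w.2.1‖ ≤ ‖w‖ := (norm_fst_le w.2).trans p2
  have p22 : ‖w.2.2‖ ≤ ‖w‖ := (norm_snd_le w.2).trans p2
  have p211 : ‖w.2.1.1‖ ≤ ‖w‖ := (norm_fst_le w.2.1).trans p21
  have p212 : ‖w.2.1.2‖ ≤ ‖w‖ := (norm_snd_le w.2.1).trans p21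
  have p221 : ‖w.2.2.1‖ ≤ ‖w‖ := (norm_fst_le w.2.2).trans p22
  have p222 : ‖w.2.2.2‖ ≤ ‖w‖ := (norm_snd_le w.2.2).trans p22
  have key : ∀ t : ℝ, ‖t‖ ≤ ‖w‖ → t ∈ Icc (-‖w‖) ‖w‖ := fun t ht => abs_le.1 ht
  exact ⟨fun i j => key _ ((norm_le_pi_norm _ j).trans ((norm_le_pi_norm _ i).trans p11)),
    fun i => key _ ((norm_le_pi_norm _ i).trans p12),
    fun l i j => key _ ((norm_le_pi_norm _ j).trans ((norm_le_pi_norm _ i).trans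
      ((norm_le_pi_norm _ l).trans p211))),
    fun l i => key _ ((norm_le_pi_norm _ i).trans ((norm_le_pi_norm _ l).trans p212)),
    fun i => key _ ((norm_le_pi_norm _ i).trans p221), key _ p222⟩

theorem FFNNParam.Bounded.mono {d H K : ℕ} {w : FFNNParam d H K} {R R' : ℝ}
    (h : FFNNParam.Bounded R w) (hR : R ≤ R') : FFNNParam.Bounded R' w := by
  have hI : Icc (-R) R ⊆ Icc (-R') R' := Icc_subset_Icc (neg_le_neg hR) hR
  exact ⟨fun i j => hI (h.1 i j), fun i => hI (h.2.1 i), fun l i j => hI (h.2.2.1 l i j),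
    fun l i => hI (h.2.2.2.1 l i), fun i => hI (h.2.2.2.2.1 i), hI h.2.2.2.2.2⟩

/-- A network is realized in every wider family with large enough weights. -/
theorem exists_mem_FFNN_of_le {d H K₀ : ℕ} {X : Set (EuclideanSpace ℝ (Fin d))} {σ ρ : ℝ → ℝ}
    (w : FFNNParam d H K₀) (hw : ∀ x ∈ X, ffnnOut σ ρ w x ∈ Icc (0 : ℝ) 1) {K : ℕ} (hK : K₀ ≤ K)
    {R : ℝ} (hR : ‖w‖ ≤ R) :
    ∃ w' ∈ FFNN X σ ρ H K R, ∀ x, ffnnOut σ ρ w' x = ffnnOut σ ρ w x := by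
  obtain ⟨m, rfl⟩ := Nat.exists_eq_add_of_le hK
  obtain ⟨w', hb, hw'⟩ := w.exists_pad σ ρ m
  exact ⟨w', ⟨hb R ((norm_nonneg w).trans hR) (w.bounded_norm.mono hR),
    fun x hx => by rw [hw' x]; exact hw x hx⟩, hw'⟩

theorem continuous_layerStack {K : ℕ} {σ : ℝ → ℝ} (hσ : Continuous σ) (L : ℕ) :
    Continuous fun q : (Fin L → Fin K → Fin K → ℝ) × (Fin L → Fin K → ℝ) × (Fin K → ℝ) =>
      layerStack σ L q.1 q.2.1 q.2.2 := by
  induction L with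
  | zero => exact continuous_snd.snd
  | succ L ih =>
    simp only [layerStack]
    refine ih.comp (f := fun q : (Fin (L + 1) → Fin K → Fin K → ℝ) × (Fin (L + 1) → Fin K → ℝ) ×
      (Fin K → ℝ) => (fun l => q.1 l.succ, fun l => q.2.1 l.succ,
        denseLayer σ (q.1 0) (q.2.1 0) q.2.2)) ?_
    unfold denseLayer
    fun_prop

theorem continuous_ffnnOut {d H K : ℕ} {σ ρ : ℝ → ℝ} (hσ : Continuous σ) (hρ : Continuous ρ) :
    Continuous fun q : FFNNParam d H K × EuclideanSpace ℝ (Fin d) => ffnnOut σ ρ q.1 q.2 := by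
  have h1 : Continuous fun q : FFNNParam d H K × EuclideanSpace ℝ (Fin d) =>
      layerStack σ (H - 1) q.1.hidW q.1.hidB (denseLayer σ q.1.inW q.1.inB (fun j => q.2 j)) := by
    refine (continuous_layerStack hσ (H - 1)).comp
      (f := fun q : FFNNParam d H K × EuclideanSpace ℝ (Fin d) =>
        (q.1.hidW, q.1.hidB, denseLayer σ q.1.inW q.1.inB (fun j => q.2 j))) ?_
    unfold denseLayer FFNNParam.hidW FFNNParam.hidB FFNNParam.inW FFNNParam.inB
    fun_prop
  unfold ffnnOut FFNNParam.outW FFNNParam.outB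
  refine hρ.comp ((continuous_finsetSum _ fun i _ => Continuous.mul (by fun_prop) ?_).add
    (by fun_prop))
  exact (continuous_apply i).comp h1

theorem isCompact_FFNN {d : ℕ} (X : Set (EuclideanSpace ℝ (Fin d))) {σ ρ : ℝ → ℝ}
    (hσ : Continuous σ) (hρ : Continuous ρ) (H K : ℕ) {R : ℝ} (hR : 0 ≤ R) :
    IsCompact (FFNN X σ ρ H K R) := by
  refine Metric.isCompact_of_isClosed_isBounded ?_ ?_
  · have h1 : IsClosed {w : FFNNParam d H K | ∀ x ∈ X, ffnnOut σ ρ w x ∈ Icc (0 : ℝ) 1} := by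
      simp only [ofPred_forall]
      refine isClosed_iInter fun x => isClosed_iInter fun _ => isClosed_Icc.preimage ?_
      exact (continuous_ffnnOut hσ hρ).comp (by fun_prop : Continuous fun w => (w, x))
    have h2 : IsClosed {w : FFNNParam d H K | FFNNParam.Bounded R w} := by
      unfold FFNNParam.Bounded FFNNParam.outW FFNNParam.outB FFNNParam.hidW FFNNParam.hidB
        FFNNParam.inW FFNNParam.inB
      simp only [ofPred_and, ofPred_forall]
      refine IsClosed.inter (isClosed_iInter fun i => isClosed_iInter fun j => ?_)
        (IsClosed.inter (isClosed_iInter fun i => ?_) (IsClosed.inter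
        (isClosed_iInter fun l => isClosed_iInter fun i => isClosed_iInter fun j => ?_)
        (IsClosed.inter (isClosed_iInter fun l => isClosed_iInter fun i => ?_)
        (IsClosed.inter (isClosed_iInter fun i => ?_) ?_)))) <;>
      exact isClosed_Icc.preimage (by fun_prop)
    exact h2.inter h1
  · refine Metric.isBounded_closedBall (x := (0 : FFNNParam d H K)) (r := R) |>.subset ?_
    rintro w ⟨⟨h1, h2, h3, h4, h5, h6⟩, -⟩
    rw [mem_closedBall_zero_iff]
    refine norm_prod_le_iff.2 ⟨norm_prod_le_iff.2 ⟨?_, ?_⟩, norm_prod_le_iff.2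
      ⟨norm_prod_le_iff.2 ⟨?_, ?_⟩, norm_prod_le_iff.2 ⟨?_, abs_le.2 h6⟩⟩⟩
    · exact (pi_norm_le_iff_of_nonneg hR).2 fun i => (pi_norm_le_iff_of_nonneg hR).2 fun j =>
        abs_le.2 (h1 i j)
    · exact (pi_norm_le_iff_of_nonneg hR).2 fun i => abs_le.2 (h2 i)
    · exact (pi_norm_le_iff_of_nonneg hR).2 fun l => (pi_norm_le_iff_of_nonneg hR).2 fun i =>
        (pi_norm_le_iff_of_nonneg hR).2 fun j => abs_le.2 (h3 l i j)
    · exact (pi_norm_le_iff_of_nonneg hR).2 fun l => (pi_norm_le_iff_of_nonneg hR).2 fun i =>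
        abs_le.2 (h4 l i)
    · exact (pi_norm_le_iff_of_nonneg hR).2 fun i => abs_le.2 (h5 i)

/-- A monotone continuous output map has continuous approximate right inverses, obtained by
inverting the strictly increasing map `t ↦ ρ t + κ t`. -/
theorem IsOutputMap.exists_approx_inverse {ρ : ℝ → ℝ} (hρ : IsOutputMap ρ) {ε : ℝ} (hε : 0 < ε) :
    ∃ (B : ℝ) (s : ℝ → ℝ), Continuous s ∧ ∀ y ∈ Icc ε (1 - ε), |s y| ≤ B ∧ |ρ (s y) - y| ≤ ε := by
  obtain ⟨_, ⟨t₀, rfl⟩, hlo⟩ := Metric.mem_closure_iff.1 (hρ.dense ⟨le_rfl, zero_le_one⟩) ε hε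
  obtain ⟨_, ⟨t₁, rfl⟩, hhi⟩ := Metric.mem_closure_iff.1 (hρ.dense ⟨zero_le_one, le_rfl⟩) ε hε
  rw [Real.dist_eq] at hlo hhi
  replace hlo := abs_lt.1 hlo
  replace hhi := abs_lt.1 hhi
  set B : ℝ := |t₀| + |t₁| + 1 with hB
  have hB0 : 0 < B := by positivity
  set κ : ℝ := ε / B with hκ
  have hκ0 : 0 < κ := by positivity
  have hmono : StrictMono fun t => ρ t + κ * t := fun t t' h =>
    add_lt_add_of_le_of_lt (hρ.mono h.le) (mul_lt_mul_of_pos_left h hκ0)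
  have hcont : Continuous fun t => ρ t + κ * t := by have := hρ.cont; fun_prop
  have hsurj : Function.Surjective fun t => ρ t + κ * t := by
    refine hcont.surjective ?_ ?_
    · refine tendsto_atTop_mono' _ ?_ (tendsto_atTop_add_const_left atTop (ρ 0)
        (tendsto_id.const_mul_atTop hκ0))
      filter_upwards [eventually_ge_atTop 0] with t ht
      exact add_le_add_left (hρ.mono ht) _
    · refine tendsto_atBot_mono' _ ?_ (tendsto_atBot_add_const_left atBot (ρ 0)
        (tendsto_id.const_mul_atBot hκ0))
      filter_upwards [eventually_le_atBot 0] with t ht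
      exact add_le_add_left (hρ.mono ht) _
  let e := hmono.orderIsoOfSurjective _ hsurj
  refine ⟨B, e.symm, e.symm.continuous, fun y hy => ?_⟩
  set t := e.symm y with ht
  have hty : ρ t + κ * t = y := e.apply_symm_apply y
  have htB : |t| ≤ B := by
    rw [abs_le]
    constructor
    · by_contra! hlt
      have h1 : ρ t ≤ ρ t₀ := hρ.mono (by linarith [neg_abs_le t₀, abs_nonneg t₁])
      have h2 : κ * t < 0 := mul_neg_of_pos_of_neg hκ0 (by linarith)
      linarith [hy.1]
    · by_contra! hlt
      have h1 : ρ t₁ ≤ ρ t := hρ.mono (by linarith [le_abs_self t₁, abs_nonneg t₀])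
      have h2 : 0 < κ * t := mul_pos hκ0 (by linarith)
      linarith [hy.2]
  refine ⟨htB, ?_⟩
  rw [← hty, sub_add_cancel_left, abs_neg, abs_mul, abs_of_pos hκ0, hκ]
  calc ε / B * |t| ≤ ε / B * B := mul_le_mul_of_nonneg_left htB hκ0.le
    _ = ε := by field_simp

/-- Uniform approximation of a continuous target with values in `[0,1]` by deep networks with output
map `ρ` and predictions in `[0,1]`. The target is first moved away from `0` and `1`, so that the
error of the approximation cannot leave `[0,1]`. -/
theorem exists_network_approx {d : ℕ} {X : Set (EuclideanSpace ℝ (Fin d))} (hX : IsCompact X)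
    {σ : ℝ → ℝ} (hσ : Continuous σ) (hσ_poly : ¬ ∃ q : Polynomial ℝ, ∀ t, σ t = q.eval t)
    {a s : ℝ} (hs : s ≠ 0) (hd : HasDerivAt σ s a) {ρ : ℝ → ℝ} (hρ : IsOutputMap ρ) (H : ℕ)
    {u : EuclideanSpace ℝ (Fin d) → ℝ} (hu : ContinuousOn u X)
    (hu01 : ∀ x ∈ X, u x ∈ Icc (0 : ℝ) 1) {ε : ℝ} (hε : 0 < ε) :
    ∃ (K : ℕ) (w : FFNNParam d H K), ∀ x ∈ X,
      ffnnOut σ ρ w x ∈ Icc (0 : ℝ) 1 ∧ |ffnnOut σ ρ w x - u x| ≤ ε := by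
  have : CompactSpace X := isCompact_iff_compactSpace.1 hX
  set η : ℝ := min ε 1 / 4 with hη
  have hm : 0 < min ε 1 := lt_min hε one_pos
  have hη0 : 0 < η := by positivity
  have hη4 : 4 * η ≤ ε := by rw [hη]; linarith [min_le_left ε 1]
  have hη1 : 4 * η ≤ 1 := by rw [hη]; linarith [min_le_right ε 1]
  obtain ⟨B, r, hr, hrB⟩ := hρ.exists_approx_inverse hη0
  -- `v` is the target moved into `[2η, 1 - 2η]`.
  let v : X → ℝ := fun x => 2 * η + (1 - 4 * η) * u x
  have hv : ∀ x : X, v x ∈ Icc (2 * η) (1 - 2 * η) ∧ |v x - u x| ≤ 2 * η := by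
    intro x
    obtain ⟨h0, h1⟩ := hu01 x x.2
    refine ⟨⟨?_, ?_⟩, abs_le.2 ⟨?_, ?_⟩⟩ <;> simp only [v] <;> nlinarith
  obtain ⟨δ, hδ0, hδ⟩ : ∃ δ > 0, ∀ t t' : ℝ, |t'| ≤ B → |t - t'| < δ → |ρ t - ρ t'| < η := by
    have huc := (isCompact_Icc (a := -(B + 1)) (b := B + 1)).uniformContinuousOn_of_continuous
      hρ.cont.continuousOn
    obtain ⟨δ, hδ0, hδ⟩ := Metric.uniformContinuousOn_iff.1 huc η hη0
    refine ⟨min δ 1, lt_min hδ0 one_pos, fun t t' ht' htt' => ?_⟩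
    have h1 := abs_le.1 ht'
    have h2 := abs_lt.1 (htt'.trans_le (min_le_right _ _))
    exact hδ t ⟨by linarith, by linarith⟩ t' ⟨by linarith, by linarith⟩
      (htt'.trans_le (min_le_left _ _))
  let τ : Fin d → C(X, ℝ) := fun j => ⟨fun x => (x : EuclideanSpace ℝ (Fin d)) j, by fun_prop⟩
  have hτ : ∀ x y : X, (∀ j, τ j x = τ j y) → x = y := fun x y h =>
    Subtype.ext (PiLp.ext h)
  obtain ⟨K, c, w, b, hc⟩ := exists_shallow_approx τ hτ ⟨σ, hσ⟩ hσ_poly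
    ⟨fun x => r (v x), hr.comp
      ((continuousOn_iff_continuous_domRestrict.1 hu).const_mul _ |>.const_add _)⟩
    (half_pos hδ0)
  let h : X → Fin K → ℝ := fun x => denseLayer σ w b (fun j => (x : EuclideanSpace ℝ (Fin d)) j)
  have hh : Continuous h := by
    unfold h denseLayer
    fun_prop
  obtain ⟨D, hD⟩ := (isCompact_univ (X := X)).exists_bound_of_continuousOn hh.continuousOn
  obtain ⟨M, b', c', c₀', hc'⟩ := exists_layerStack_approx hσ hs hd (H - 1) h
    (fun x i => (norm_le_pi_norm (h x) i).trans (hD x trivial)) c 0 (half_pos hδ0)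
  refine ⟨K, ⟨⟨w, b⟩, ⟨M, b'⟩, ⟨c', c₀'⟩⟩, fun x hx => ?_⟩
  obtain ⟨⟨hv0, hv1⟩, hvu⟩ := hv ⟨x, hx⟩
  obtain ⟨hrB1, hrB2⟩ := hrB (v ⟨x, hx⟩) ⟨by linarith, by linarith⟩
  have h1 := hc ⟨x, hx⟩
  have h2 := hc' ⟨x, hx⟩
  rw [add_zero] at h2
  have h3 := hδ _ _ hrB1 ((abs_sub_le _ _ _).trans_lt (add_lt_add h2 h1) |>.trans_eq
    (add_halves δ))
  change |ffnnOut σ ρ (⟨⟨w, b⟩, ⟨M, b'⟩, ⟨c', c₀'⟩⟩ : FFNNParam d H K) x - _| < η at h3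
  rw [abs_le] at hvu hrB2 ⊢
  rw [abs_lt] at h3
  exact ⟨⟨by linarith, by linarith⟩, by linarith, by linarith⟩

/-! ### Binary processes -/

section BinaryProcess

variable {d : ℕ} {X : Set (EuclideanSpace ℝ (Fin d))} {μ : Measure (DataPoint d)}
  {p : EuclideanSpace ℝ (Fin d) → ℝ} {g : DataPoint d → ℝ}

theorem isCompact_dataSpace (hX : IsCompact X) : IsCompact (dataSpace X) :=
  hX.prod (Set.toFinite _).isCompact

theorem measurableSet_dataSpace (hX : IsCompact X) : MeasurableSet (dataSpace X) :=
  (isCompact_dataSpace hX).measurableSet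

theorem mem_dataSpace {z : DataPoint d} :
    z ∈ dataSpace X ↔ z.1 ∈ X ∧ (z.2 = 0 ∨ z.2 = 1) := by
  simp [dataSpace, mem_prod]

theorem label_mem_Icc {y : ℝ} (hy : y = 0 ∨ y = 1) : y ∈ Icc (0 : ℝ) 1 := by
  rcases hy with rfl | rfl <;> simp

theorem measurableSet_sublevel (hX : IsCompact X) (hg : ContinuousOn g (dataSpace X)) (c : ℝ) :
    MeasurableSet (dataSpace X ∩ g ⁻¹' Iic c) :=
  (hg.preimage_isClosed_of_isClosed (isCompact_dataSpace hX).isClosed isClosed_Iic).measurableSet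

/-- The conditional probability `p`, set to `0` outside `X`: unlike `p`, it is measurable. -/
noncomputable def labelProb (X : Set (EuclideanSpace ℝ (Fin d)))
    (p : EuclideanSpace ℝ (Fin d) → ℝ) : EuclideanSpace ℝ (Fin d) → ℝ := X.indicator p

theorem IsBinaryProcess.labelProb_mem (hμ : IsBinaryProcess X μ p)
    (x : EuclideanSpace ℝ (Fin d)) : labelProb X p x ∈ Icc (0 : ℝ) 1 := by
  by_cases hx : x ∈ X
  · rw [labelProb, indicator_of_mem hx]
    exact hμ.p_mem x hx
  · rw [labelProb, indicator_of_notMem hx]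
    simp

theorem IsBinaryProcess.measurable_labelProb (hμ : IsBinaryProcess X μ p) (hX : IsCompact X) :
    Measurable (labelProb X p) := by
  refine UpperSemicontinuous.measurable fun x c hc => ?_
  by_cases hx : x ∈ X
  · have hcx : p x < c := by simpa [labelProb, hx] using hc
    have h := hμ.p_usc x hx c hcx
    have h0 : 0 < c := (hμ.p_mem x hx).1.trans_lt hcx
    filter_upwards [eventually_nhdsWithin_iff.1 h] with y hy
    by_cases hyX : y ∈ X
    · simpa [labelProb, hyX] using hy hyX
    · simpa [labelProb, hyX] using h0
  · filter_upwards [hX.isClosed.isOpen_compl.mem_nhds hx] with y hy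
    have hy' : y ∉ X := hy
    simpa [labelProb, hx, hy'] using hc

theorem IsBinaryProcess.ae_mem (hμ : IsBinaryProcess X μ p) : ∀ᵐ z ∂μ, z ∈ dataSpace X :=
  hμ.carried

theorem IsBinaryProcess.marginal_ae_mem (hμ : IsBinaryProcess X μ p) (hX : IsCompact X) :
    ∀ᵐ x ∂(μ.map Prod.fst), x ∈ X :=
  hμ.marginal_ac (ae_restrict_mem hX.measurableSet)

theorem IsBinaryProcess.isProbabilityMeasure_marginal (hμ : IsBinaryProcess X μ p) :
    IsProbabilityMeasure (μ.map Prod.fst) :=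
  have := hμ.isProb
  Measure.isProbabilityMeasure_map measurable_fst.aemeasurable

theorem IsBinaryProcess.measure_prod_one (hμ : IsBinaryProcess X μ p) (hX : IsCompact X)
    {s : Set (EuclideanSpace ℝ (Fin d))} (hs : MeasurableSet s) :
    μ (s ×ˢ ({1} : Set ℝ)) = ∫⁻ x in s, ENNReal.ofReal (labelProb X p x) ∂(μ.map Prod.fst) := by
  rw [hμ.p_cond s hs]
  refine lintegral_congr_ae (ae_restrict_of_ae ?_)
  filter_upwards [hμ.marginal_ae_mem hX] with x hx
  simp [labelProb, hx]

theorem IsBinaryProcess.measure_eq_add (hμ : IsBinaryProcess X μ p)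
    {s : Set (DataPoint d)} (hs : MeasurableSet s) :
    μ s = μ (((fun x => (x, (0 : ℝ))) ⁻¹' s) ×ˢ {0}) +
      μ (((fun x => (x, (1 : ℝ))) ⁻¹' s) ×ˢ {1}) := by
  have hm0 : MeasurableSet ((fun x : EuclideanSpace ℝ (Fin d) => (x, (0 : ℝ))) ⁻¹' s) :=
    measurable_prodMk_right hs
  have hm1 : MeasurableSet ((fun x : EuclideanSpace ℝ (Fin d) => (x, (1 : ℝ))) ⁻¹' s) :=
    measurable_prodMk_right hs
  rw [← measure_union _ (hm1.prod (measurableSet_singleton 1))]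
  · refine measure_congr ?_
    filter_upwards [hμ.ae_mem] with z hz
    obtain ⟨x, y⟩ := z
    refine propext ?_
    change (x, y) ∈ s ↔ (x, y) ∈
      (((fun x => (x, (0 : ℝ))) ⁻¹' s) ×ˢ ({0} : Set ℝ) ∪
      ((fun x => (x, (1 : ℝ))) ⁻¹' s) ×ˢ ({1} : Set ℝ) : Set (DataPoint d))
    rcases (mem_dataSpace.1 hz).2 with h | h <;> obtain rfl : y = _ := h <;> simp
  · rw [disjoint_left]
    rintro ⟨x, y⟩ ⟨-, h0⟩ ⟨-, h1⟩
    simp only [mem_singleton_iff] at h0 h1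
    exact zero_ne_one (h0.symm.trans h1)

theorem IsBinaryProcess.measure_prod_zero (hμ : IsBinaryProcess X μ p) (hX : IsCompact X)
    {s : Set (EuclideanSpace ℝ (Fin d))} (hs : MeasurableSet s) :
    μ (s ×ˢ ({0} : Set ℝ)) =
      ∫⁻ x in s, ENNReal.ofReal (1 - labelProb X p x) ∂(μ.map Prod.fst) := by
  have := hμ.isProb
  have hq := hμ.measurable_labelProb hX
  have h1 : μ (s ×ˢ ({0} : Set ℝ)) + μ (s ×ˢ ({1} : Set ℝ)) = μ.map Prod.fst s := by
    rw [Measure.map_apply measurable_fst hs, hμ.measure_eq_add (measurable_fst hs)]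
    rfl
  have h2 : (∫⁻ x in s, ENNReal.ofReal (1 - labelProb X p x) ∂(μ.map Prod.fst)) +
      μ (s ×ˢ ({1} : Set ℝ)) = μ.map Prod.fst s := by
    rw [hμ.measure_prod_one hX hs, ← lintegral_add_right _ hq.ennreal_ofReal]
    have : ∀ x, ENNReal.ofReal (1 - labelProb X p x) + ENNReal.ofReal (labelProb X p x) = 1 := by
      intro x
      obtain ⟨h0, h1⟩ := hμ.labelProb_mem x
      rw [← ENNReal.ofReal_add (by linarith) h0, sub_add_cancel, ENNReal.ofReal_one]
    simp [this]
  exact (ENNReal.add_left_inj (measure_ne_top _ _)).1 (h1.trans h2.symm)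

/-- Disintegration of a binary process over its labels. -/
theorem IsBinaryProcess.integral_eq (hμ : IsBinaryProcess X μ p) (hX : IsCompact X)
    {F : DataPoint d → ℝ} (hF : Measurable F) {M : ℝ} (hM : ∀ z ∈ dataSpace X, |F z| ≤ M) :
    ∫ z, F z ∂μ =
      ∫ x, ((1 - labelProb X p x) * F (x, 0) + labelProb X p x * F (x, 1)) ∂(μ.map Prod.fst) := by
  have := hμ.isProb
  have := hμ.isProbabilityMeasure_marginal
  have hq := hμ.measurable_labelProb hX
  set m := μ.map Prod.fst with hm
  have hμeq : μ = (m.withDensity fun x => ENNReal.ofReal (1 - labelProb X p x)).map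
        (fun x => (x, (0 : ℝ))) +
      (m.withDensity fun x => ENNReal.ofReal (labelProb X p x)).map (fun x => (x, (1 : ℝ))) := by
    ext s hs
    have hm0 : MeasurableSet ((fun x : EuclideanSpace ℝ (Fin d) => (x, (0 : ℝ))) ⁻¹' s) :=
      measurable_prodMk_right hs
    have hm1 : MeasurableSet ((fun x : EuclideanSpace ℝ (Fin d) => (x, (1 : ℝ))) ⁻¹' s) :=
      measurable_prodMk_right hs
    rw [Measure.add_apply, Measure.map_apply measurable_prodMk_right hs,
      Measure.map_apply measurable_prodMk_right hs, withDensity_apply _ hm0,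
      withDensity_apply _ hm1, hμ.measure_eq_add hs, hμ.measure_prod_zero hX hm0,
      hμ.measure_prod_one hX hm1]
  have hFi : Integrable F μ := by
    refine Integrable.of_bound hF.aestronglyMeasurable M ?_
    filter_upwards [hμ.ae_mem] with z hz using hM z hz
  have hI : ∀ y : ℝ, y = 0 ∨ y = 1 → ∀ r : EuclideanSpace ℝ (Fin d) → ℝ, Measurable r →
      (∀ x, r x ∈ Icc (0 : ℝ) 1) → Integrable (fun x => r x * F (x, y)) m := by
    intro y hy r hr hr01
    refine Integrable.of_bound (hr.mul (hF.comp measurable_prodMk_right)).aestronglyMeasurable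
      M ?_
    filter_upwards [hμ.marginal_ae_mem hX] with x hx
    have := hM (x, y) (mem_dataSpace.2 ⟨hx, hy⟩)
    rw [Real.norm_eq_abs, abs_mul, abs_of_nonneg (hr01 x).1]
    calc _ ≤ 1 * |F (x, y)| := mul_le_mul_of_nonneg_right (hr01 x).2 (abs_nonneg _)
      _ ≤ M := by rwa [one_mul]
  have hdens : ∀ y : ℝ, ∀ r : EuclideanSpace ℝ (Fin d) → ℝ, Measurable r →
      (∀ x, r x ∈ Icc (0 : ℝ) 1) →
      ∫ z, F z ∂((m.withDensity fun x => ENNReal.ofReal (r x)).map (fun x => (x, y))) =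
        ∫ x, r x * F (x, y) ∂m := by
    intro y r hr hr01
    rw [integral_map measurable_prodMk_right.aemeasurable hF.aestronglyMeasurable,
      integral_withDensity_eq_integral_toReal_smul hr.ennreal_ofReal
        (Eventually.of_forall fun _ => ENNReal.ofReal_lt_top)]
    refine integral_congr_ae (Eventually.of_forall fun x => ?_)
    simp [ENNReal.toReal_ofReal (hr01 x).1]
  have hr0 : ∀ x, 1 - labelProb X p x ∈ Icc (0 : ℝ) 1 := fun x => by
    obtain ⟨h0, h1⟩ := hμ.labelProb_mem x
    exact ⟨by linarith, by linarith⟩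
  rw [integral_add (hI 0 (Or.inl rfl) (fun x => 1 - labelProb X p x) (measurable_const.sub hq) hr0)
    (hI 1 (Or.inr rfl) _ hq hμ.labelProb_mem),
    ← hdens 0 (fun x => 1 - labelProb X p x) (measurable_const.sub hq) hr0,
    ← hdens 1 _ hq hμ.labelProb_mem]
  rw [hμeq] at hFi
  rw [← integral_add_measure hFi.left_of_add_measure hFi.right_of_add_measure, ← hμeq]

/-- The level sets of an adapted score are null for every binary process. -/
theorem IsBinaryProcess.measure_level_eq_zero (hμ : IsBinaryProcess X μ p) (hX : IsCompact X)
    (hg : IsAdapted X g) (c : ℝ) : μ (dataSpace X ∩ g ⁻¹' {c}) = 0 := by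
  by_cases hc : c ∈ g '' dataSpace X
  · have hN : MeasurableSet (dataSpace X ∩ g ⁻¹' {c}) :=
      (hg.1.preimage_isClosed_of_isClosed (isCompact_dataSpace hX).isClosed
        isClosed_singleton).measurableSet
    have h0 := Measure.measure_ae_null_of_prod_null (hg.2 c hc)
    have hsec : ∀ y : ℝ, y = 0 ∨ y = 1 →
        μ (((fun x => (x, y)) ⁻¹' (dataSpace X ∩ g ⁻¹' {c})) ×ˢ {y}) = 0 := by
      intro y hy
      have hsub : ((fun x : EuclideanSpace ℝ (Fin d) => (x, y)) ⁻¹'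
          (dataSpace X ∩ g ⁻¹' {c})) ×ˢ {y}
          ⊆ Prod.fst ⁻¹' ((fun x => (x, y)) ⁻¹' (dataSpace X ∩ g ⁻¹' {c})) := fun z hz => hz.1
      refine measure_mono_null hsub ?_
      rw [← Measure.map_apply measurable_fst (measurable_prodMk_right hN)]
      refine hμ.marginal_ac ?_
      rw [measure_eq_zero_iff_ae_notMem]
      filter_upwards [h0] with x hx
      intro hmem
      have hz : (Measure.dirac (0 : ℝ) + Measure.dirac (1 : ℝ))
          (Prod.mk x ⁻¹' (dataSpace X ∩ g ⁻¹' {c})) = 0 := hx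
      rw [Measure.add_apply, add_eq_zero, Measure.dirac_apply' _ (measurable_prodMk_left hN),
        Measure.dirac_apply' _ (measurable_prodMk_left hN)] at hz
      have hmem' : y ∈ Prod.mk x ⁻¹' (dataSpace X ∩ g ⁻¹' {c}) := hmem
      rcases hy with rfl | rfl
      · exact absurd hz.1 (by rw [indicator_of_mem hmem']; simp)
      · exact absurd hz.2 (by rw [indicator_of_mem hmem']; simp)
    rw [hμ.measure_eq_add hN, hsec 0 (Or.inl rfl), hsec 1 (Or.inr rfl), add_zero]
  · convert measure_empty (μ := μ)
    rw [eq_empty_iff_forall_notMem]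
    rintro z ⟨hz, hzc⟩
    exact hc ⟨z, hz, hzc⟩

/-- The score outside of the data space is replaced by `0`, which makes it measurable. -/
theorem measurable_indicator_score (hX : IsCompact X) (hg : ContinuousOn g (dataSpace X)) :
    Measurable ((dataSpace X).indicator g) := by
  classical
  rw [← piecewise_eq_indicator]
  exact hg.measurable_piecewise continuousOn_const (measurableSet_dataSpace hX)

/-- As the score has no atoms, some sublevel set has probability strictly between `0` and `1`. -/
theorem IsBinaryProcess.exists_sublevel (hμ : IsBinaryProcess X μ p) (hX : IsCompact X)
    (hg : IsAdapted X g) :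
    ∃ c, 0 < μ.real (dataSpace X ∩ g ⁻¹' Iic c) ∧ μ.real (dataSpace X ∩ g ⁻¹' Iic c) < 1 := by
  have := hμ.isProb
  have hgm := measurable_indicator_score hX hg.1
  set m := μ.map ((dataSpace X).indicator g) with hm
  have : IsProbabilityMeasure m := Measure.isProbabilityMeasure_map hgm.aemeasurable
  have happ : ∀ t : Set ℝ, MeasurableSet t → m t = μ (dataSpace X ∩ g ⁻¹' t) := by
    intro t ht
    rw [hm, Measure.map_apply hgm ht]
    refine measure_congr ?_
    filter_upwards [hμ.ae_mem] with z hz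
    refine propext ?_
    change (dataSpace X).indicator g z ∈ t ↔ z ∈ dataSpace X ∧ g z ∈ t
    simp [hz]
  have hcont : Continuous (cdf m) := by
    rw [continuous_iff_continuousAt]
    intro a
    refine ((cdf m).mono.continuousAt_iff_leftLim_eq_rightLim).2 ?_
    have h1 := (cdf m).measure_singleton a
    rw [measure_cdf, happ _ (measurableSet_singleton a), hμ.measure_level_eq_zero hX hg a] at h1
    have h2 := ENNReal.ofReal_eq_zero.1 h1.symm
    rw [(cdf m).rightLim_eq]
    exact le_antisymm ((cdf m).mono.leftLim_le le_rfl) (by linarith)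
  obtain ⟨c, hc⟩ : (1 / 2 : ℝ) ∈ range (cdf m) := by
    refine mem_range_of_exists_le_of_exists_ge hcont ?_ ?_
    · exact ((tendsto_cdf_atBot m).eventually (eventually_le_nhds (by norm_num))).exists
    · exact ((tendsto_cdf_atTop m).eventually (eventually_ge_nhds (by norm_num))).exists
  rw [cdf_eq_real, measureReal_def, happ _ measurableSet_Iic, ← measureReal_def] at hc
  exact ⟨c, by rw [hc]; norm_num, by rw [hc]; norm_num⟩

end BinaryProcess

/-! ### Risks of measurable predictors -/

/-- The loss with both arguments clamped to `[0,1]`: a continuous extension of the loss to the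
plane. -/
noncomputable def clampLoss (loss : ℝ → ℝ → ℝ) (y y' : ℝ) : ℝ :=
  loss (projIcc 0 1 zero_le_one y : ℝ) (projIcc 0 1 zero_le_one y' : ℝ)

theorem clampLoss_eq {loss : ℝ → ℝ → ℝ} {y y' : ℝ} (hy : y ∈ Icc (0 : ℝ) 1)
    (hy' : y' ∈ Icc (0 : ℝ) 1) : clampLoss loss y y' = loss y y' := by
  rw [clampLoss, projIcc_of_mem _ hy, projIcc_of_mem _ hy']

theorem continuous_clampLoss {loss : ℝ → ℝ → ℝ}
    (h : ContinuousOn (fun y : ℝ × ℝ => loss y.1 y.2) (Icc (0 : ℝ) 1 ×ˢ Icc (0 : ℝ) 1)) :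
    Continuous fun y : ℝ × ℝ => clampLoss loss y.1 y.2 := by
  refine h.comp_continuous (f := fun y : ℝ × ℝ => ((projIcc 0 1 zero_le_one y.1 : ℝ),
    (projIcc 0 1 zero_le_one y.2 : ℝ))) ?_ fun y => ⟨Subtype.coe_prop _, Subtype.coe_prop _⟩
  have := continuous_projIcc (a := (0 : ℝ)) (b := 1) (h := zero_le_one)
  fun_prop

theorem LossSeparates.clampLoss {loss : ℝ → ℝ → ℝ} (h : LossSeparates loss) :
    LossSeparates (clampLoss loss) := by
  intro y hy y' hy'
  rw [clampLoss_eq hy hy']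
  exact h y hy y' hy'

theorem LossHasIncreasingMinimizer.clampLoss {loss : ℝ → ℝ → ℝ}
    (h : LossHasIncreasingMinimizer loss) : LossHasIncreasingMinimizer (clampLoss loss) := by
  obtain ⟨ystar, hmono, hmin⟩ := h
  have h0 : (0 : ℝ) ∈ Icc (0 : ℝ) 1 := by simp
  have h1 : (1 : ℝ) ∈ Icc (0 : ℝ) 1 := by simp
  refine ⟨ystar, hmono, fun q hq => ⟨(hmin q hq).1, fun y hy hne => ?_⟩⟩
  have hs := (hmin q hq).1
  rw [clampLoss_eq hs h0, clampLoss_eq hs h1, clampLoss_eq hy h0, clampLoss_eq hy h1]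
  exact (hmin q hq).2 y hy hne

theorem exists_loss_bound {ℓ : ℝ → ℝ → ℝ} (hℓ : Continuous fun y : ℝ × ℝ => ℓ y.1 y.2) :
    ∃ M, ∀ y ∈ Icc (0 : ℝ) 1, ∀ y' ∈ Icc (0 : ℝ) 1, |ℓ y y'| ≤ M := by
  obtain ⟨M, hM⟩ := ((isCompact_Icc (a := (0 : ℝ)) (b := 1)).prod
    (isCompact_Icc (a := (0 : ℝ)) (b := 1))).exists_bound_of_continuousOn hℓ.continuousOn
  exact ⟨M, fun y hy y' hy' => hM (y, y') ⟨hy, hy'⟩⟩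

/-- The expected loss of the predictor `f` under `ν`. -/
noncomputable def risk {d : ℕ} (ℓ : ℝ → ℝ → ℝ) (ν : Measure (DataPoint d))
    (f : EuclideanSpace ℝ (Fin d) → ℝ) : ℝ := ∫ z, ℓ (f z.1) z.2 ∂ν

/-- Measurable predictors on `X` with predictions in `[0,1]`. -/
def IsPredictor {d : ℕ} (X : Set (EuclideanSpace ℝ (Fin d)))
    (f : EuclideanSpace ℝ (Fin d) → ℝ) : Prop :=
  Measurable f ∧ ∀ x ∈ X, f x ∈ Icc (0 : ℝ) 1

section Risk

variable {d : ℕ} {X : Set (EuclideanSpace ℝ (Fin d))} {μ : Measure (DataPoint d)}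
  {p : EuclideanSpace ℝ (Fin d) → ℝ} {ℓ : ℝ → ℝ → ℝ}

theorem measurable_loss_comp (hℓ : Continuous fun y : ℝ × ℝ => ℓ y.1 y.2)
    {f : EuclideanSpace ℝ (Fin d) → ℝ} (hf : Measurable f) :
    Measurable fun z : DataPoint d => ℓ (f z.1) z.2 :=
  hℓ.measurable.comp ((hf.comp measurable_fst).prodMk measurable_snd)

theorem IsPredictor.abs_loss_le {M : ℝ}
    (hM : ∀ y ∈ Icc (0 : ℝ) 1, ∀ y' ∈ Icc (0 : ℝ) 1, |ℓ y y'| ≤ M)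
    {f : EuclideanSpace ℝ (Fin d) → ℝ} (hf : IsPredictor X f) {z : DataPoint d}
    (hz : z ∈ dataSpace X) : |ℓ (f z.1) z.2| ≤ M :=
  hM _ (hf.2 _ (mem_dataSpace.1 hz).1) _ (label_mem_Icc (mem_dataSpace.1 hz).2)

theorem IsPredictor.integrable (hμ : IsBinaryProcess X μ p)
    (hℓ : Continuous fun y : ℝ × ℝ => ℓ y.1 y.2) {f : EuclideanSpace ℝ (Fin d) → ℝ}
    (hf : IsPredictor X f) : Integrable (fun z : DataPoint d => ℓ (f z.1) z.2) μ := by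
  have := hμ.isProb
  obtain ⟨M, hM⟩ := exists_loss_bound hℓ
  refine Integrable.of_bound (measurable_loss_comp hℓ hf.1).aestronglyMeasurable M ?_
  filter_upwards [hμ.ae_mem] with z hz using hf.abs_loss_le hM hz

/-- Measurable functions with values in `[0,1]` are almost everywhere limits of continuous ones. -/
theorem exists_continuous_tendsto_ae {m : Measure (EuclideanSpace ℝ (Fin d))} [IsFiniteMeasure m]
    {f : EuclideanSpace ℝ (Fin d) → ℝ} (hf : Measurable f) (hf01 : ∀ᵐ x ∂m, f x ∈ Icc (0 : ℝ) 1) :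
    ∃ u : ℕ → EuclideanSpace ℝ (Fin d) → ℝ, (∀ n, Continuous (u n)) ∧
      (∀ n x, u n x ∈ Icc (0 : ℝ) 1) ∧ ∀ᵐ x ∂m, Tendsto (fun n => u n x) atTop (𝓝 (f x)) := by
  have hfi : Integrable f m := by
    refine Integrable.of_bound hf.aestronglyMeasurable 1 ?_
    filter_upwards [hf01] with x hx
    exact abs_le.2 ⟨by linarith [hx.1], hx.2⟩
  choose v _ hv2 hv3 hv4 using fun n : ℕ =>
    hfi.exists_hasCompactSupport_integral_sub_le (ε := 1 / (n + 1)) (by positivity)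
  have hlim : Tendsto (fun n => eLpNorm (v n - f) 1 m) atTop (𝓝 0) := by
    have h0 : Tendsto (fun n : ℕ => ENNReal.ofReal (1 / ((n : ℝ) + 1))) atTop (𝓝 0) := by
      rw [← ENNReal.ofReal_zero]
      exact ENNReal.tendsto_ofReal tendsto_one_div_add_atTop_nhds_zero_nat
    refine tendsto_of_tendsto_of_tendsto_of_le_of_le tendsto_const_nhds h0 (fun _ => zero_le)
      fun n => ?_
    dsimp only
    rw [eLpNorm_one_eq_lintegral_enorm, ← ofReal_integral_norm_eq_lintegral_enorm
      ((hv4 n).sub hfi)]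
    refine ENNReal.ofReal_le_ofReal (le_trans (le_of_eq ?_) (hv2 n))
    exact integral_congr_ae (Eventually.of_forall fun x => norm_sub_rev _ _)
  obtain ⟨ns, -, hns⟩ := (tendstoInMeasure_of_tendsto_eLpNorm one_ne_zero
    (fun n => (hv3 n).aestronglyMeasurable) hf.aestronglyMeasurable hlim).exists_seq_tendsto_ae
  have hproj : Continuous fun y : ℝ => (projIcc 0 1 zero_le_one y : ℝ) :=
    continuous_subtype_val.comp continuous_projIcc
  refine ⟨fun n x => projIcc 0 1 zero_le_one (v (ns n) x), fun n => hproj.comp (hv3 _),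
    fun n x => Subtype.coe_prop _, ?_⟩
  filter_upwards [hns, hf01] with x hx hx01
  have := (hproj.tendsto (f x)).comp hx
  rwa [projIcc_of_mem _ hx01] at this

/-- A family of continuous models that approximates continuous predictors uniformly also
approximates measurable predictors in expected loss. -/
theorem exists_integral_loss_sub_lt (hX : IsCompact X) (hμ : IsBinaryProcess X μ p)
    (hℓ : Continuous fun y : ℝ × ℝ => ℓ y.1 y.2) {Θ : Type*}
    {yout : Θ → EuclideanSpace ℝ (Fin d) → ℝ} (hcont : ∀ θ, Continuous (yout θ))
    (happ : ∀ u : EuclideanSpace ℝ (Fin d) → ℝ, Continuous u → (∀ x, u x ∈ Icc (0 : ℝ) 1) →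
      ∀ ε > 0, ∃ θ, ∀ x ∈ X, yout θ x ∈ Icc (0 : ℝ) 1 ∧ |yout θ x - u x| ≤ ε)
    {f : EuclideanSpace ℝ (Fin d) → ℝ} (hf : IsPredictor X f) {ε : ℝ} (hε : 0 < ε) :
    ∃ θ, (∀ x ∈ X, yout θ x ∈ Icc (0 : ℝ) 1) ∧
      ∫ z, |ℓ (yout θ z.1) z.2 - ℓ (f z.1) z.2| ∂μ < ε := by
  have := hμ.isProb
  have := hμ.isProbabilityMeasure_marginal
  have hXm := hμ.marginal_ae_mem hX
  obtain ⟨u, hu, hu01, hlim⟩ := exists_continuous_tendsto_ae (m := μ.map Prod.fst) hf.1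
    (by filter_upwards [hXm] with x hx using hf.2 x hx)
  choose θ hθ using fun n : ℕ => happ (u n) (hu n) (hu01 n) (1 / (n + 1)) (by positivity)
  have hpred : ∀ n, IsPredictor X (yout (θ n)) := fun n =>
    ⟨(hcont _).measurable, fun x hx => (hθ n x hx).1⟩
  have hlim' : ∀ᵐ z ∂μ, Tendsto (fun n => yout (θ n) z.1) atTop (𝓝 (f z.1)) := by
    have h1 : ∀ᵐ x ∂(μ.map Prod.fst), Tendsto (fun n => yout (θ n) x) atTop (𝓝 (f x)) := by
      filter_upwards [hXm, hlim] with x hx hxlim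
      have h0 : Tendsto (fun n => yout (θ n) x - u n x) atTop (𝓝 0) :=
        squeeze_zero_norm (fun n => (hθ n x hx).2) tendsto_one_div_add_atTop_nhds_zero_nat
      simpa using h0.add hxlim
    exact ae_of_ae_map measurable_fst.aemeasurable h1
  obtain ⟨M, hM⟩ := exists_loss_bound hℓ
  have hdct : Tendsto (fun n => ∫ z, |ℓ (yout (θ n) z.1) z.2 - ℓ (f z.1) z.2| ∂μ) atTop
      (𝓝 (∫ _, (0 : ℝ) ∂μ)) := by
    refine tendsto_integral_of_dominated_convergence (fun _ => M + M) (fun n => ?_)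
      (integrable_const _) (fun n => ?_) ?_
    · exact (((hpred n).integrable hμ hℓ).sub (hf.integrable hμ hℓ)).abs.aestronglyMeasurable
    · filter_upwards [hμ.ae_mem] with z hz
      rw [Real.norm_eq_abs, abs_abs]
      exact (abs_sub _ _).trans (add_le_add ((hpred n).abs_loss_le hM hz) (hf.abs_loss_le hM hz))
    · filter_upwards [hlim'] with z hz
      have hc : Continuous fun y : ℝ => |ℓ y z.2 - ℓ (f z.1) z.2| :=
        ((hℓ.comp (by fun_prop : Continuous fun y : ℝ => (y, z.2))).sub continuous_const).abs
      have h0 := (hc.tendsto (f z.1)).comp hz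
      rw [sub_self, abs_zero] at h0
      exact h0
  rw [integral_zero] at hdct
  obtain ⟨n, hn⟩ := (hdct.eventually_lt_const hε).exists
  exact ⟨θ n, fun x hx => (hθ n x hx).1, hn⟩

theorem abs_risk_sub_le (hμ : IsBinaryProcess X μ p)
    (hℓ : Continuous fun y : ℝ × ℝ => ℓ y.1 y.2) {f f' : EuclideanSpace ℝ (Fin d) → ℝ}
    (hf : IsPredictor X f) (hf' : IsPredictor X f') (S : Set (DataPoint d)) :
    |risk ℓ (μ.restrict S) f - risk ℓ (μ.restrict S) f'| ≤
      ∫ z, |ℓ (f z.1) z.2 - ℓ (f' z.1) z.2| ∂μ := by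
  have h1 := hf.integrable hμ hℓ
  have h2 := hf'.integrable hμ hℓ
  rw [risk, risk, ← integral_sub h1.restrict h2.restrict]
  refine (abs_integral_le_integral_abs).trans ?_
  exact setIntegral_le_integral (h1.sub h2).abs (Eventually.of_forall fun _ => abs_nonneg _)

/-- The risk of a predictor with two values. -/
theorem risk_piecewise (hμ : IsBinaryProcess X μ p) (S : Set (DataPoint d))
    {T : Set (EuclideanSpace ℝ (Fin d))} (hT : MeasurableSet T)
    [DecidablePred (· ∈ T)] (a b : ℝ) :
    risk ℓ (μ.restrict S) (T.piecewise (fun _ => a) (fun _ => b)) =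
      μ.real (T ×ˢ {0} ∩ S) * ℓ a 0 + μ.real (T ×ˢ {1} ∩ S) * ℓ a 1 +
      (μ.real (Tᶜ ×ˢ {0} ∩ S) * ℓ b 0 + μ.real (Tᶜ ×ˢ {1} ∩ S) * ℓ b 1) := by
  have := hμ.isProb
  have hm : ∀ (U : Set (EuclideanSpace ℝ (Fin d))), MeasurableSet U → ∀ y : ℝ,
      MeasurableSet (U ×ˢ ({y} : Set ℝ)) := fun U hU y => hU.prod (measurableSet_singleton y)
  have hI : ∀ (U : Set (EuclideanSpace ℝ (Fin d))), MeasurableSet U → ∀ y c : ℝ,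
      Integrable ((U ×ˢ ({y} : Set ℝ)).indicator fun _ => c) (μ.restrict S) := fun U hU y c =>
    (integrable_const c).indicator (hm U hU y)
  have hv : ∀ (U : Set (EuclideanSpace ℝ (Fin d))), MeasurableSet U → ∀ y c : ℝ,
      ∫ z, (U ×ˢ ({y} : Set ℝ)).indicator (fun _ => c) z ∂(μ.restrict S) =
        μ.real (U ×ˢ {y} ∩ S) * c := by
    intro U hU y c
    rw [integral_indicator_const _ (hm U hU y), measureReal_restrict_apply (hm U hU y), smul_eq_mul]
  rw [← hv T hT 0, ← hv T hT 1, ← hv Tᶜ hT.compl 0, ← hv Tᶜ hT.compl 1,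
    ← integral_add' (hI T hT 0 _) (hI T hT 1 _), ← integral_add' (hI _ hT.compl 0 _)
      (hI _ hT.compl 1 _), ← integral_add' ((hI T hT 0 _).add (hI T hT 1 _))
      ((hI _ hT.compl 0 _).add (hI _ hT.compl 1 _)), risk]
  refine integral_congr_ae (ae_restrict_of_ae ?_)
  filter_upwards [hμ.ae_mem] with z hz
  obtain ⟨x, y⟩ := z
  rcases (mem_dataSpace.1 hz).2 with h | h <;> obtain rfl : y = _ := h <;>
  by_cases hx : x ∈ T <;> simp [hx, indicator]

/-- Restricting a binary process to an event of probability strictly between `0` and `1` changes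
the normalized risk of some predictor. Otherwise the signed measures `μ (S ∩ T × {y}) - μ S *
μ (T × {y})` for the two labels would be proportional with factor `ℓ 1 0 / ℓ 0 1`, and unless they
vanish, this would make a convex combination of `ℓ · 1` and `ℓ · 0` constant, against the uniqueness
of its minimizer. -/
theorem exists_risk_restrict_ne (hμ : IsBinaryProcess X μ p) (hℓi : LossSeparates ℓ)
    (hℓii : LossHasIncreasingMinimizer ℓ) {S : Set (DataPoint d)} (hS : MeasurableSet S)
    (hS0 : 0 < μ.real S) (hS1 : μ.real S < 1) :
    ∃ f, IsPredictor X f ∧ risk ℓ (μ.restrict S) f ≠ μ.real S * risk ℓ μ f := by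
  classical
  have := hμ.isProb
  have h0 : (0 : ℝ) ∈ Icc (0 : ℝ) 1 := by simp
  have h1 : (1 : ℝ) ∈ Icc (0 : ℝ) 1 := by simp
  by_contra! hcon
  set r := μ.real S with hr
  have hl01 : 0 < ℓ 0 1 := lt_of_le_of_ne (hℓi 0 h0 1 h1).1
    fun h => zero_ne_one ((hℓi 0 h0 1 h1).2.1 h.symm)
  have hl10 : 0 < ℓ 1 0 := lt_of_le_of_ne (hℓi 1 h1 0 h0).1
    fun h => one_ne_zero ((hℓi 1 h1 0 h0).2.1 h.symm)
  have hl00 : ℓ 0 0 = 0 := (hℓi 0 h0 0 h0).2.2 rfl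
  have hl11 : ℓ 1 1 = 0 := (hℓi 1 h1 1 h1).2.2 rfl
  have key : ∀ T : Set (EuclideanSpace ℝ (Fin d)), MeasurableSet T → ∀ y : ℝ, y = 0 ∨ y = 1 →
      μ.real (T ×ˢ {y} ∩ S) = r * μ.real (T ×ˢ {y}) := by
    intro T hT
    set κ₀ := μ.real (T ×ˢ {0} ∩ S) - r * μ.real (T ×ˢ {0}) with hκ₀
    set κ₁ := μ.real (T ×ˢ {1} ∩ S) - r * μ.real (T ×ˢ {1}) with hκ₁
    have hpw : ∀ a ∈ Icc (0 : ℝ) 1, κ₀ * (ℓ a 0 - ℓ 0 0) + κ₁ * (ℓ a 1 - ℓ 0 1) = 0 := by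
      intro a ha
      have hP : ∀ a ∈ Icc (0 : ℝ) 1, IsPredictor X (T.piecewise (fun _ => a) (fun _ => 0)) := by
        intro a ha
        refine ⟨measurable_const.piecewise hT measurable_const, fun x _ => ?_⟩
        by_cases hx : x ∈ T <;> simp only [hx, piecewise_eq_of_mem, piecewise_eq_of_notMem,
          not_false_eq_true, ha, h0]
      have e1 := hcon _ (hP a ha)
      have e2 := hcon _ (hP 0 h0)
      rw [← Measure.restrict_univ (μ := μ), Measure.restrict_restrict hS, inter_univ,
        risk_piecewise hμ _ hT, risk_piecewise hμ _ hT] at e1 e2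
      simp only [inter_univ] at e1 e2
      rw [hκ₀, hκ₁]
      linear_combination e1 - e2
    -- The affine relation at `a = 1` gives the proportionality factor `t`.
    have hone := hpw 1 h1
    rw [hl00, hl11] at hone
    obtain ⟨t, ht⟩ : ∃ t, κ₁ = t * ℓ 1 0 := ⟨κ₁ / ℓ 1 0, by field_simp⟩
    have ht0 : κ₀ = t * ℓ 0 1 := by
      rw [ht] at hone
      have : ℓ 1 0 * (κ₀ - t * ℓ 0 1) = 0 := by linear_combination hone
      rcases mul_eq_zero.1 this with h | h
      · exact absurd h hl10.ne'
      · linarith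
    have htz : t = 0 := by
      by_contra htne
      have hconst : ∀ a ∈ Icc (0 : ℝ) 1, ℓ 0 1 * ℓ a 0 + ℓ 1 0 * ℓ a 1 = ℓ 1 0 * ℓ 0 1 := by
        intro a ha
        have h2 := hpw a ha
        rw [ht, ht0, hl00] at h2
        have : t * (ℓ 0 1 * ℓ a 0 + ℓ 1 0 * ℓ a 1 - ℓ 1 0 * ℓ 0 1) = 0 := by
          linear_combination h2
        rcases mul_eq_zero.1 this with h | h
        · exact absurd h htne
        · linarith
      obtain ⟨ystar, -, hmin⟩ := hℓii
      set s := ℓ 1 0 + ℓ 0 1 with hs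
      have hs0 : 0 < s := add_pos hl10 hl01
      set q := ℓ 1 0 / s with hq
      have hq01 : q ∈ Icc (0 : ℝ) 1 :=
        ⟨(div_pos hl10 hs0).le, (div_le_one hs0).2 (by linarith)⟩
      obtain ⟨hy, hlt⟩ := hmin q hq01
      obtain ⟨a, ha, hne⟩ : ∃ a ∈ Icc (0 : ℝ) 1, a ≠ ystar q := by
        by_cases h : (0 : ℝ) = ystar q
        · exact ⟨1, h1, fun h' => zero_ne_one (h.trans h'.symm)⟩
        · exact ⟨0, h0, h⟩
      have hval : ∀ y ∈ Icc (0 : ℝ) 1, q * ℓ y 1 + (1 - q) * ℓ y 0 = ℓ 1 0 * ℓ 0 1 / s := by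
        intro y hy
        rw [← hconst y hy, hq, show (1 : ℝ) - ℓ 1 0 / s = ℓ 0 1 / s by field_simp; ring]
        ring
      have := hlt a ha hne
      rw [hval a ha, hval _ hy] at this
      exact lt_irrefl _ this
    rw [htz, zero_mul] at ht ht0
    rintro y (rfl | rfl)
    · linarith
    · linarith
  -- Apply the identity to the sections of the complement of `S`.
  have hsec : ∀ y : ℝ, y = 0 ∨ y = 1 → μ (((fun x => (x, y)) ⁻¹' Sᶜ) ×ˢ {y}) = 0 := by
    intro y hy
    have h2 := key ((fun x => (x, y)) ⁻¹' Sᶜ) (measurable_prodMk_right hS.compl) y hy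
    have h3 : (((fun x => (x, y)) ⁻¹' Sᶜ) ×ˢ ({y} : Set ℝ) ∩ S : Set (DataPoint d)) = ∅ := by
      rw [eq_empty_iff_forall_notMem]
      rintro ⟨x, y'⟩ ⟨⟨hx, rfl⟩, hxS⟩
      exact hx hxS
    rw [h3, measureReal_empty] at h2
    rcases mul_eq_zero.1 h2.symm with h | h
    · exact absurd h hS0.ne'
    · exact (measureReal_eq_zero_iff).1 h
  have hcompl : μ Sᶜ = 0 := by
    rw [hμ.measure_eq_add hS.compl, hsec 0 (Or.inl rfl), hsec 1 (Or.inr rfl), add_zero]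
  have := (prob_compl_eq_zero_iff hS).1 hcompl
  rw [hr, measureReal_def, this] at hS1
  simp at hS1

end Risk

/-! ### Two risks without a common minimizer -/

section TwoRisks

variable {d : ℕ} {X : Set (EuclideanSpace ℝ (Fin d))} {μ : Measure (DataPoint d)}
  {p : EuclideanSpace ℝ (Fin d) → ℝ} {ℓ : ℝ → ℝ → ℝ}

theorem IsPredictor.piecewise {B : Set (EuclideanSpace ℝ (Fin d))} [DecidablePred (· ∈ B)]
    (hB : MeasurableSet B) {f f' : EuclideanSpace ℝ (Fin d) → ℝ} (hf : IsPredictor X f)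
    (hf' : IsPredictor X f') : IsPredictor X (B.piecewise f f') := by
  refine ⟨hf.1.piecewise hB hf'.1, fun x hx => ?_⟩
  by_cases hxB : x ∈ B
  · rw [piecewise_eq_of_mem _ _ _ hxB]; exact hf.2 x hx
  · rw [piecewise_eq_of_notMem _ _ _ hxB]; exact hf'.2 x hx

theorem isPredictor_const {c : ℝ} (hc : c ∈ Icc (0 : ℝ) 1) :
    IsPredictor X (fun _ => c) := ⟨measurable_const, fun _ _ => hc⟩

theorem risk_nonneg (hμ : IsBinaryProcess X μ p) (hℓi : LossSeparates ℓ)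
    (S : Set (DataPoint d)) {f : EuclideanSpace ℝ (Fin d) → ℝ} (hf : IsPredictor X f) :
    0 ≤ risk ℓ (μ.restrict S) f := by
  refine integral_nonneg_of_ae (ae_restrict_of_ae ?_)
  filter_upwards [hμ.ae_mem] with z hz
  exact (hℓi _ (hf.2 _ (mem_dataSpace.1 hz).1) _ (label_mem_Icc (mem_dataSpace.1 hz).2)).1

/-- Predictors whose risk is within `ε` of the infimum over all predictors. -/
theorem exists_near_minimizer (hμ : IsBinaryProcess X μ p) (hℓi : LossSeparates ℓ)
    (S : Set (DataPoint d)) {ε : ℝ} (hε : 0 < ε) :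
    ∃ f, IsPredictor X f ∧ ∀ f', IsPredictor X f' →
      risk ℓ (μ.restrict S) f < risk ℓ (μ.restrict S) f' + ε := by
  set R := risk ℓ (μ.restrict S) '' {f | IsPredictor X f} with hR
  have hbdd : BddBelow R := ⟨0, by rintro _ ⟨f, hf, rfl⟩; exact risk_nonneg hμ hℓi S hf⟩
  have hne : R.Nonempty := ⟨_, _, isPredictor_const (c := 0) (by simp), rfl⟩
  obtain ⟨_, ⟨f, hf, rfl⟩, hlt⟩ := exists_lt_of_csInf_lt hne (lt_add_of_pos_right (sInf R) hε)
  refine ⟨f, hf, fun f' hf' => hlt.trans_le ?_⟩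
  have := csInf_le hbdd ⟨f', hf', rfl⟩
  linarith

/-- The weight of the label `lab ∈ {0, 1}` at an input whose label is `1` with probability `q`. -/
def labelWeight (lab q : ℝ) : ℝ := lab * q + (1 - lab) * (1 - q)

/-- The expected loss of the prediction `y` for a label that is `1` with probability `q`. -/
def pointRisk (ℓ : ℝ → ℝ → ℝ) (q y : ℝ) : ℝ := q * ℓ y 1 + (1 - q) * ℓ y 0

/-- No prediction in `[0,1]` minimizes both the expected loss at `q ∈ (0,1)` and the loss for a
fixed label; quantitatively, the sum of the two exceeds the minimum of the first by a positive
amount. The infimum of the sum is continuous in `q`, hence measurable along `p`. -/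
theorem exists_pointRisk_gap (hℓ : Continuous fun y : ℝ × ℝ => ℓ y.1 y.2)
    (hℓi : LossSeparates ℓ) {ystar : ℝ → ℝ} (hmono : StrictMonoOn ystar (Icc 0 1))
    (hmin : ∀ q ∈ Icc (0 : ℝ) 1, ystar q ∈ Icc (0 : ℝ) 1 ∧ ∀ y ∈ Icc (0 : ℝ) 1, y ≠ ystar q →
        pointRisk ℓ q (ystar q) < pointRisk ℓ q y) {lab : ℝ} (hlab : lab = 0 ∨ lab = 1) :
    ∃ V : ℝ → ℝ, Continuous V ∧
      (∀ q, ∀ y ∈ Icc (0 : ℝ) 1, V q ≤ pointRisk ℓ q y + labelWeight lab q * ℓ y lab) ∧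
      (∀ q ∈ Icc (0 : ℝ) 1, pointRisk ℓ q (ystar q) ≤ V q) ∧
      ∀ q ∈ Ioo (0 : ℝ) 1, pointRisk ℓ q (ystar q) < V q := by
  have h0 : (0 : ℝ) ∈ Icc (0 : ℝ) 1 := by simp
  have h1 : (1 : ℝ) ∈ Icc (0 : ℝ) 1 := by simp
  have hlab' := label_mem_Icc hlab
  let ψ : ℝ → ℝ → ℝ := fun q y => pointRisk ℓ q y + labelWeight lab q * ℓ y lab
  have hψ : Continuous ↿ψ := by
    have hc : ∀ c : ℝ, Continuous fun z : ℝ × ℝ => ℓ z.2 c := fun c =>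
      hℓ.comp (by fun_prop : Continuous fun z : ℝ × ℝ => (z.2, c))
    have hc0 := hc 0
    have hc1 := hc 1
    have hcl := hc lab
    change Continuous fun z : ℝ × ℝ => (z.1 * ℓ z.2 1 + (1 - z.1) * ℓ z.2 0) +
      (lab * z.1 + (1 - lab) * (1 - z.1)) * ℓ z.2 lab
    fun_prop
  have hψq : ∀ q, Continuous (ψ q) := fun q =>
    hψ.comp (by fun_prop : Continuous fun y : ℝ => (q, y))
  have hw : ∀ q ∈ Icc (0 : ℝ) 1, 0 ≤ labelWeight lab q := by
    rintro q ⟨hq0, hq1⟩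
    rcases hlab with rfl | rfl <;> simp [labelWeight, hq0, hq1]
  have hle : ∀ q ∈ Icc (0 : ℝ) 1, ∀ y ∈ Icc (0 : ℝ) 1,
      pointRisk ℓ q (ystar q) ≤ pointRisk ℓ q y := by
    intro q hq y hy
    by_cases h : y = ystar q
    · rw [h]
    · exact ((hmin q hq).2 y hy h).le
  refine ⟨fun q => sInf (ψ q '' Icc 0 1), isCompact_Icc.continuous_sInf hψ, ?_, ?_, ?_⟩
  · intro q y hy
    exact csInf_le (isCompact_Icc.image (hψq q)).bddBelow ⟨y, hy, rfl⟩
  · intro q hq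
    refine le_csInf ⟨_, 0, h0, rfl⟩ ?_
    rintro _ ⟨y, hy, rfl⟩
    have := mul_nonneg (hw q hq) (hℓi y hy lab hlab').1
    exact (hle q hq y hy).trans (le_add_of_nonneg_right this)
  · intro q hq
    have hq' : q ∈ Icc (0 : ℝ) 1 := Ioo_subset_Icc_self hq
    obtain ⟨y, hy, hyeq⟩ := isCompact_Icc.exists_sInf_image_eq ⟨0, h0⟩ (hψq q).continuousOn
    dsimp only
    rw [hyeq]
    have hw' : 0 < labelWeight lab q := by
      obtain ⟨hq0, hq1⟩ := hq
      rcases hlab with rfl | rfl <;> simp [labelWeight, hq0, hq1]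
    by_cases hyl : y = lab
    · subst hyl
      have hne : y ≠ ystar q := by
        rcases hlab with rfl | rfl
        · have := hmono h0 hq' hq.1
          exact (((hmin 0 h0).1.1).trans_lt this).ne
        · have := hmono hq' h1 hq.2
          exact (this.trans_le (hmin 1 h1).1.2).ne'
      exact ((hmin q hq').2 y hy hne).trans_le
        (le_add_of_nonneg_right (mul_nonneg hw'.le (hℓi y hy y hy).1))
    · have hpos : 0 < ℓ y lab := lt_of_le_of_ne (hℓi y hy lab hlab').1
        fun h => hyl ((hℓi y hy lab hlab').2.1 h.symm)
      exact (hle q hq' y hy).trans_lt (lt_add_of_pos_right _ (mul_pos hw' hpos))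

/-- If the event `S` keeps exactly the label `lab` on a set `B` of inputs where both labels can
happen, then no predictor is nearly optimal for `μ` and for `μ` restricted to `S` at once: on `B`,
near-optimality for `μ` forces predictions close to the minimizer of the pointwise risk,
near-optimality for the restriction forces predictions close to `lab`. -/
theorem exists_no_common_near_minimizer (hX : IsCompact X) (hμ : IsBinaryProcess X μ p)
    (hℓ : Continuous fun y : ℝ × ℝ => ℓ y.1 y.2) (hℓi : LossSeparates ℓ)
    (hℓii : LossHasIncreasingMinimizer ℓ) {S : Set (DataPoint d)} (hS : MeasurableSet S)
    {B : Set (EuclideanSpace ℝ (Fin d))} (hB : MeasurableSet B) {lab : ℝ}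
    (hlab : lab = 0 ∨ lab = 1) (hSB : ∀ z ∈ dataSpace X, z.1 ∈ B → (z ∈ S ↔ z.2 = lab))
    (hpos : 0 < μ.map Prod.fst (B ∩ {x | labelProb X p x ∈ Ioo (0 : ℝ) 1})) :
    ∃ f₁ f₂, IsPredictor X f₁ ∧ IsPredictor X f₂ ∧ ∃ ε > 0, ∀ f, IsPredictor X f →
      risk ℓ μ f ≤ risk ℓ μ f₁ + ε →
        risk ℓ (μ.restrict S) f₂ + ε < risk ℓ (μ.restrict S) f := by
  classical
  have := hμ.isProb
  have := hμ.isProbabilityMeasure_marginal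
  obtain ⟨ystar, hmono, hmin⟩ := hℓii
  obtain ⟨V, hVc, hVle, hVge, hVgt⟩ := exists_pointRisk_gap hℓ hℓi hmono hmin hlab
  obtain ⟨M, hM⟩ := exists_loss_bound hℓ
  have hlab' := label_mem_Icc hlab
  set m := μ.map Prod.fst with hm
  set q := labelProb X p with hq
  have hqm : Measurable q := hμ.measurable_labelProb hX
  have hq01 : ∀ x, q x ∈ Icc (0 : ℝ) 1 := hμ.labelProb_mem
  let b : EuclideanSpace ℝ (Fin d) → ℝ := fun x => ystar (q x)
  have hbm : Measurable b := by
    have h1 : Monotone fun t : ℝ => ystar (projIcc 0 1 zero_le_one t) := fun t t' h =>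
      hmono.monotoneOn (Subtype.coe_prop _) (Subtype.coe_prop _) (monotone_projIcc _ h)
    have h2 : b = (fun t : ℝ => ystar (projIcc 0 1 zero_le_one t)) ∘ q := by
      ext x
      simp only [b, Function.comp]
      rw [projIcc_of_mem _ (hq01 x)]
    rw [h2]
    exact h1.measurable.comp hqm
  have hb : IsPredictor X b := ⟨hbm, fun x _ => (hmin _ (hq01 x)).1⟩
  let gap : EuclideanSpace ℝ (Fin d) → ℝ := fun x => V (q x) - pointRisk ℓ (q x) (b x)
  have hgap0 : ∀ x, 0 ≤ gap x := fun x => sub_nonneg.2 (hVge _ (hq01 x))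
  have hgapm : Measurable gap := by
    have hc : ∀ c : ℝ, Measurable fun x => ℓ (b x) c := fun c =>
      hℓ.measurable.comp (hbm.prodMk measurable_const)
    have hc0 := hc 0
    have hc1 := hc 1
    exact (hVc.measurable.comp hqm).sub ((hqm.mul hc1).add ((measurable_const.sub hqm).mul hc0))
  have hgapi : Integrable gap m := by
    refine Integrable.of_bound hgapm.aestronglyMeasurable M (Eventually.of_forall fun x => ?_)
    rw [Real.norm_eq_abs, abs_of_nonneg (hgap0 x)]
    have hbx := (hmin _ (hq01 x)).1
    have h1 := hVle (q x) (b x) hbx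
    have h2 : labelWeight lab (q x) ≤ 1 := by
      obtain ⟨h3, h4⟩ := hq01 x
      rcases hlab with rfl | rfl <;> simp [labelWeight, h3, h4]
    have h3 := mul_le_mul_of_nonneg_right h2 (hℓi (b x) hbx lab hlab').1
    have h4 := (le_abs_self _).trans (hM (b x) hbx lab hlab')
    simp only [gap]
    linarith
  have hI : 0 < ∫ x in B, gap x ∂m := by
    rw [setIntegral_pos_iff_support_of_nonneg_ae (Eventually.of_forall hgap0) hgapi.integrableOn]
    refine hpos.trans_le (measure_mono ?_)
    rintro x ⟨hxB, hx⟩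
    exact ⟨(sub_pos.2 (hVgt _ hx)).ne', hxB⟩
  set ε := (∫ x in B, gap x ∂m) / 4 with hε
  have hε0 : 0 < ε := by positivity
  obtain ⟨f₁, hf₁, hn₁⟩ := exists_near_minimizer hμ hℓi univ hε0
  obtain ⟨f₂, hf₂, hn₂⟩ := exists_near_minimizer hμ hℓi S hε0
  rw [Measure.restrict_univ] at hn₁
  refine ⟨f₁, f₂, hf₁, hf₂, ε, hε0, fun f hf hle₁ => ?_⟩
  by_contra! hle₂
  -- The competitors: the pointwise minimizer on `B`, respectively the label `lab` on `B`.
  have hfb := hb.piecewise hB hf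
  have hfl := (isPredictor_const (X := X) hlab').piecewise hB hf
  set fb := B.piecewise b f with hfbdef
  set fl := B.piecewise (fun _ => lab) f with hfldef
  let D : DataPoint d → ℝ := fun z => (ℓ (f z.1) z.2 - ℓ (fb z.1) z.2) +
    S.indicator (fun z => ℓ (f z.1) z.2 - ℓ (fl z.1) z.2) z
  have hDm : Measurable D :=
    ((measurable_loss_comp hℓ hf.1).sub (measurable_loss_comp hℓ hfb.1)).add
      (((measurable_loss_comp hℓ hf.1).sub (measurable_loss_comp hℓ hfl.1)).indicator hS)
  have hDM : ∀ z ∈ dataSpace X, |D z| ≤ (M + M) + (M + M) := by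
    intro z hz
    refine (abs_add_le _ _).trans (add_le_add ?_ ?_)
    · exact (abs_sub _ _).trans (add_le_add (hf.abs_loss_le hM hz) (hfb.abs_loss_le hM hz))
    · have h1 := (abs_sub _ _).trans
        (add_le_add (hf.abs_loss_le hM hz) (hfl.abs_loss_le hM hz))
      by_cases hzS : z ∈ S
      · rwa [indicator_of_mem hzS]
      · rw [indicator_of_notMem hzS, abs_zero]
        exact (abs_nonneg _).trans h1
  have hDint : ∫ z, D z ∂μ = (risk ℓ μ f - risk ℓ μ fb) +
      (risk ℓ (μ.restrict S) f - risk ℓ (μ.restrict S) fl) := by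
    have i1 := hf.integrable hμ hℓ
    have i2 := hfb.integrable hμ hℓ
    have i3 := hfl.integrable hμ hℓ
    simp only [risk]
    rw [← integral_sub i1 i2, ← integral_sub i1.restrict i3.restrict, ← integral_indicator hS]
    exact integral_add (i1.sub i2) ((i1.sub i3).indicator hS)
  have hlow : ∫ x in B, gap x ∂m ≤ ∫ z, D z ∂μ := by
    rw [hμ.integral_eq hX hDm hDM, ← integral_indicator hB]
    refine integral_mono_ae (hgapi.indicator hB) ?_ ?_
    · have hr0 : ∀ x, |1 - q x| ≤ 1 := fun x => by
        obtain ⟨h0, h1⟩ := hq01 x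
        exact abs_le.2 ⟨by linarith, by linarith⟩
      have hr1 : ∀ x, |q x| ≤ 1 := fun x => by
        obtain ⟨h0, h1⟩ := hq01 x
        exact abs_le.2 ⟨by linarith, by linarith⟩
      refine Integrable.of_bound (((measurable_const.sub hqm).mul
        (hDm.comp measurable_prodMk_right)).add (hqm.mul
        (hDm.comp measurable_prodMk_right))).aestronglyMeasurable
        (1 * ((M + M) + (M + M)) + 1 * ((M + M) + (M + M))) ?_
      filter_upwards [hμ.marginal_ae_mem hX] with x hx
      refine (abs_add_le _ _).trans (add_le_add ?_ ?_)
      · rw [abs_mul]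
        exact mul_le_mul (hr0 x) (hDM _ (mem_dataSpace.2 ⟨hx, Or.inl rfl⟩)) (abs_nonneg _)
          zero_le_one
      · rw [abs_mul]
        exact mul_le_mul (hr1 x) (hDM _ (mem_dataSpace.2 ⟨hx, Or.inr rfl⟩)) (abs_nonneg _)
          zero_le_one
    · filter_upwards [hμ.marginal_ae_mem hX] with x hx
      by_cases hxB : x ∈ B
      · have e1 : fb x = b x := piecewise_eq_of_mem _ _ _ hxB
        have e2 : fl x = lab := piecewise_eq_of_mem _ _ _ hxB
        have s0 := hSB (x, 0) (mem_dataSpace.2 ⟨hx, Or.inl rfl⟩) hxB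
        have s1 := hSB (x, 1) (mem_dataSpace.2 ⟨hx, Or.inr rfl⟩) hxB
        have hll : ℓ lab lab = 0 := (hℓi lab hlab' lab hlab').2.2 rfl
        have hV := hVle (q x) (f x) (hf.2 x hx)
        rw [indicator_of_mem hxB]
        simp only [gap, D, e1, pointRisk] at hV ⊢
        rcases hlab with rfl | rfl
        · have m0 : (x, (0 : ℝ)) ∈ S := s0.2 rfl
          have m1 : (x, (1 : ℝ)) ∉ S := fun h => one_ne_zero (s1.1 h)
          rw [indicator_of_mem m0, indicator_of_notMem m1]
          simp only [e2, hll]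
          rw [labelWeight] at hV
          linarith
        · have m0 : (x, (0 : ℝ)) ∉ S := fun h => zero_ne_one (s0.1 h)
          have m1 : (x, (1 : ℝ)) ∈ S := s1.2 rfl
          rw [indicator_of_notMem m0, indicator_of_mem m1]
          simp only [e2, hll]
          rw [labelWeight] at hV
          linarith
      · have e1 : fb x = f x := piecewise_eq_of_notMem _ _ _ hxB
        have e2 : fl x = f x := piecewise_eq_of_notMem _ _ _ hxB
        rw [indicator_of_notMem hxB]
        simp [D, e1, e2, indicator]
  have c1 := hn₁ fb hfb
  have c2 := hn₂ fl hfl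
  rw [hDint] at hlow
  linarith

/-- If the score depends on the labels, some sublevel set of the score keeps a single label on a
neighbourhood where both labels can happen. -/
theorem DependsOnLabels.exists_sublevel (hX : IsCompact X) (hμ : IsBinaryProcess X μ p)
    {g : DataPoint d → ℝ} (hg : ContinuousOn g (dataSpace X)) (h : DependsOnLabels μ p g) :
    ∃ (c : ℝ) (B : Set (EuclideanSpace ℝ (Fin d))) (lab : ℝ), MeasurableSet B ∧
      (lab = 0 ∨ lab = 1) ∧
      (∀ z ∈ dataSpace X, z.1 ∈ B → (z ∈ dataSpace X ∩ g ⁻¹' Iic c ↔ z.2 = lab)) ∧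
      0 < μ.map Prod.fst (B ∩ {x | labelProb X p x ∈ Ioo (0 : ℝ) 1}) ∧
      0 < μ.real (dataSpace X ∩ g ⁻¹' Iic c) := by
  have := hμ.isProb
  obtain ⟨x₀, -, hne, hp, hs0, hs1⟩ := h
  rw [Measure.mem_support_iff_forall] at hs0 hs1
  -- Points of the support belong to the data space, as it is closed and carries `μ`.
  have hx₀ : x₀ ∈ X := by
    by_contra hx
    have hU : (Xᶜ ×ˢ univ : Set (DataPoint d)) ∈ 𝓝 (x₀, (0 : ℝ)) :=
      prod_mem_nhds (hX.isClosed.isOpen_compl.mem_nhds hx) univ_mem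
    refine (hs0 _ hU).ne' (measure_mono_null ?_ hμ.carried)
    rintro z ⟨hz, -⟩ hzD
    exact hz (mem_dataSpace.1 hzD).1
  have hnear : ∀ y : ℝ, y = 0 ∨ y = 1 → ∀ O : Set ℝ, IsOpen O → g (x₀, y) ∈ O →
      ∀ᶠ x in 𝓝 x₀, x ∈ X → g (x, y) ∈ O := by
    intro y hy O hO hgO
    have h1 := hg (x₀, y) (mem_dataSpace.2 ⟨hx₀, hy⟩)
    have h2 : Tendsto (fun x => (x, y)) (𝓝[X] x₀) (𝓝[dataSpace X] (x₀, y)) := by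
      refine tendsto_nhdsWithin_iff.2 ⟨?_, ?_⟩
      · exact ((by fun_prop : Continuous fun x : EuclideanSpace ℝ (Fin d) => (x, y)).tendsto
          x₀).mono_left nhdsWithin_le_nhds
      · filter_upwards [self_mem_nhdsWithin] with x hx using mem_dataSpace.2 ⟨hx, hy⟩
    exact eventually_nhdsWithin_iff.1 ((h1.tendsto.comp h2).eventually (hO.mem_nhds hgO))
  have husc : ∀ᶠ x in 𝓝 x₀, x ∈ X → p x < 1 :=
    eventually_nhdsWithin_iff.1 (hμ.p_usc x₀ hx₀ 1 hp.2)
  have hposB : ∀ B : Set (EuclideanSpace ℝ (Fin d)), IsOpen B → x₀ ∈ B →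
      (∀ x ∈ B, x ∈ X → p x < 1) →
      0 < μ.map Prod.fst (B ∩ {x | labelProb X p x ∈ Ioo (0 : ℝ) 1}) := by
    intro B hB hxB hlt
    have h1 : 0 < μ (B ×ˢ ({1} : Set ℝ)) := by
      have hU : B ×ˢ Ioo (1 / 2 : ℝ) 2 ∈ 𝓝 (x₀, (1 : ℝ)) :=
        prod_mem_nhds (hB.mem_nhds hxB) (Ioo_mem_nhds (by norm_num) (by norm_num))
      refine (hs1 _ hU).trans_le (measure_mono_ae ?_)
      filter_upwards [hμ.ae_mem] with z hz
      rintro ⟨hzB, hz2⟩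
      refine ⟨hzB, ?_⟩
      rcases (mem_dataSpace.1 hz).2 with h | h
      · rw [h] at hz2
        exact absurd hz2.1 (by norm_num)
      · exact h
    rw [hμ.measure_prod_one hX hB.measurableSet, lintegral_pos_iff_support
      (hμ.measurable_labelProb hX).ennreal_ofReal, Measure.restrict_apply
      (measurableSet_support (hμ.measurable_labelProb hX).ennreal_ofReal)] at h1
    refine h1.trans_le (measure_mono_ae ?_)
    filter_upwards [hμ.marginal_ae_mem hX] with x hx
    rintro ⟨hx1, hxB'⟩
    refine ⟨hxB', ?_, ?_⟩
    · by_contra! hle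
      exact hx1 (ENNReal.ofReal_eq_zero.2 hle)
    · simpa [labelProb, hx] using hlt x hxB' hx
  -- The case distinction is on which label has the smaller score at `x₀`.
  have main : ∀ lab lab' : ℝ, (lab = 0 ∧ lab' = 1) ∨ (lab = 1 ∧ lab' = 0) →
      g (x₀, lab) < g (x₀, lab') → (∀ U ∈ 𝓝 (x₀, lab), 0 < μ U) →
      ∃ (c : ℝ) (B : Set (EuclideanSpace ℝ (Fin d))) (lab : ℝ), MeasurableSet B ∧
      (lab = 0 ∨ lab = 1) ∧
      (∀ z ∈ dataSpace X, z.1 ∈ B → (z ∈ dataSpace X ∩ g ⁻¹' Iic c ↔ z.2 = lab)) ∧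
      0 < μ.map Prod.fst (B ∩ {x | labelProb X p x ∈ Ioo (0 : ℝ) 1}) ∧
      0 < μ.real (dataSpace X ∩ g ⁻¹' Iic c) := by
    intro lab lab' hll hlt hsupp
    obtain ⟨c, hc1, hc2⟩ := exists_between hlt
    have hlab : lab = 0 ∨ lab = 1 := hll.imp And.left And.left
    have hlab' : lab' = 0 ∨ lab' = 1 := (hll.imp And.right And.right).symm
    have hlab01 : lab' ≠ lab := by
      rcases hll with ⟨rfl, rfl⟩ | ⟨rfl, rfl⟩ <;> norm_num
    have hev := (hnear lab hlab (Iio c) isOpen_Iio hc1).and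
      ((hnear lab' hlab' (Ioi c) isOpen_Ioi hc2).and husc)
    obtain ⟨B, hBsub, hBo, hxB⟩ := eventually_nhds_iff.1 hev
    have hSB : ∀ z ∈ dataSpace X, z.1 ∈ B → (z ∈ dataSpace X ∩ g ⁻¹' Iic c ↔ z.2 = lab) := by
      rintro ⟨x, y⟩ hz hxB'
      have hzX := (mem_dataSpace.1 hz).1
      have hy : y = lab ∨ y = lab' := by
        have := (mem_dataSpace.1 hz).2
        rcases hll with ⟨rfl, rfl⟩ | ⟨rfl, rfl⟩
        · exact this
        · exact this.symm
      obtain ⟨b1, b2, -⟩ := hBsub x hxB'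
      rcases hy with rfl | rfl
      · exact iff_of_true ⟨hz, mem_preimage.2 (mem_Iic.2 (mem_Iio.1 (b1 hzX)).le)⟩ rfl
      · exact iff_of_false (fun h => not_le.2 (mem_Ioi.1 (b2 hzX)) (mem_Iic.1 h.2)) hlab01
    refine ⟨c, B, lab, hBo.measurableSet, hlab, hSB,
      hposB B hBo hxB fun x hx => (hBsub x hx).2.2, ?_⟩
    rw [measureReal_def, ENNReal.toReal_pos_iff]
    refine ⟨?_, measure_lt_top _ _⟩
    have hU : B ×ˢ {y : ℝ | y ≠ lab'} ∈ 𝓝 (x₀, lab) :=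
      prod_mem_nhds (hBo.mem_nhds hxB) (isOpen_ne.mem_nhds hlab01.symm)
    refine (hsupp _ hU).trans_le (measure_mono_ae ?_)
    filter_upwards [hμ.ae_mem] with z hz
    rintro ⟨hzB, hz2⟩
    refine (hSB z hz hzB).2 ?_
    have := (mem_dataSpace.1 hz).2
    have hz2' : z.2 ≠ lab' := hz2
    rcases hll with ⟨rfl, rfl⟩ | ⟨rfl, rfl⟩
    · exact this.resolve_right hz2'
    · exact this.resolve_left hz2'
  rcases lt_or_gt_of_ne hne with h | h
  · exact main 0 1 (Or.inl ⟨rfl, rfl⟩) h hs0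
  · exact main 1 0 (Or.inr ⟨rfl, rfl⟩) h hs1

end TwoRisks

/-! ### The data kept by score-based pruning -/

section Pruning

variable {d : ℕ} {X : Set (EuclideanSpace ℝ (Fin d))} {μ : Measure (DataPoint d)}
  {p : EuclideanSpace ℝ (Fin d) → ℝ} {g : DataPoint d → ℝ}

open Classical in
theorem card_filter_le_orderStat {Z : Finset (DataPoint d)}
    (hg : InjOn g (Z : Set (DataPoint d))) {k : ℕ} (hk : 1 ≤ k) (hkZ : k ≤ Z.card) :
    (Z.filter fun z => g z ≤ orderStat g Z k).card = k := by
  set I := Z.image g with hI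
  have hcard : I.card = Z.card := Finset.card_image_of_injOn hg
  have hval : I.val = Z.val.map g := Finset.image_val_of_injOn hg
  let i₀ : Fin Z.card := ⟨k - 1, by omega⟩
  have hstat : orderStat g Z k = I.orderEmbOfFin hcard i₀ := by
    rw [Finset.orderEmbOfFin_apply, orderStat, ← hval]
    exact List.getD_eq_getElem _ _ _
  have h1 : (I.filter fun t => t ≤ orderStat g Z k) =
      (Finset.Iic i₀).map (I.orderEmbOfFin hcard).toEmbedding := by
    ext t
    simp only [Finset.mem_filter, Finset.mem_map, Finset.mem_Iic, RelEmbedding.coe_toEmbedding]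
    constructor
    · rintro ⟨ht, hle⟩
      obtain ⟨i, rfl⟩ : t ∈ range (I.orderEmbOfFin hcard) := by
        rw [Finset.range_orderEmbOfFin]; exact ht
      rw [hstat, OrderEmbedding.le_iff_le] at hle
      exact ⟨i, hle, rfl⟩
    · rintro ⟨i, hi, rfl⟩
      exact ⟨Finset.orderEmbOfFin_mem _ _ _, by rwa [hstat, OrderEmbedding.le_iff_le]⟩
  have h2 : (I.filter fun t => t ≤ orderStat g Z k) =
      (Z.filter fun z => g z ≤ orderStat g Z k).image g := by
    rw [hI, Finset.filter_image]
  rw [← Finset.card_image_of_injOn (f := g) 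
    (hg.mono fun z hz => (Finset.mem_filter.1 (Finset.mem_coe.1 hz)).1), ← h2, h1, Finset.card_map,
    Fin.card_Iic]
  simp only [i₀]
  omega

open Classical in
/-- Sums over two sublevel sets differ by at most the difference of their sizes, as one sublevel set
contains the other. -/
theorem abs_sum_sublevel_sub_le (Z : Finset (DataPoint d)) {F : DataPoint d → ℝ} {M : ℝ}
    (hF : ∀ z ∈ Z, |F z| ≤ M) (a b : ℝ) :
    |∑ z ∈ Z.filter (fun z => g z ≤ a), F z - ∑ z ∈ Z.filter (fun z => g z ≤ b), F z| ≤
      M * |((Z.filter fun z => g z ≤ a).card : ℝ) - ((Z.filter fun z => g z ≤ b).card : ℝ)| := by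
  wlog hab : b ≤ a generalizing a b
  · rw [abs_sub_comm, abs_sub_comm (Finset.card _ : ℝ)]
    exact this b a (le_of_not_ge hab)
  have hsub : Z.filter (fun z => g z ≤ b) ⊆ Z.filter (fun z => g z ≤ a) :=
    Finset.monotone_filter_right Z fun z _ hz => hz.trans hab
  rw [← Finset.sum_sdiff hsub, add_sub_cancel_right, ← Nat.cast_sub (Finset.card_le_card hsub),
    ← Finset.card_sdiff_of_subset hsub, Nat.abs_cast]
  refine (Finset.abs_sum_le_sum_abs _ _).trans ?_
  rw [mul_comm, ← nsmul_eq_mul]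
  exact Finset.sum_le_card_nsmul _ _ _ fun z hz =>
    hF z (Finset.filter_subset _ _ (Finset.sdiff_subset hz))

open Classical in
/-- Along a sequence of data with distinct scores whose empirical frequencies of `S = {g ≤ c}`
tend to `r`, pruning at level `r` amounts to restricting to `S`: it keeps `⌊r n⌋` points, hence
all but `o(n)` of the same points. -/
theorem tendsto_pruned_average {D : Set (DataPoint d)}
    {A : Finset (DataPoint d) → ℝ → Finset (DataPoint d)} (hA : IsSBPA D g A) (z : ℕ → DataPoint d)
    (hz : ∀ i, z i ∈ D) (hinj : Function.Injective fun i => g (z i)) {c r : ℝ}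
    (hr : r ∈ Ioc (0 : ℝ) 1)
    (hfreq : Tendsto (fun n : ℕ => (∑ i ∈ Finset.range n,
      (D ∩ g ⁻¹' Iic c).indicator (fun _ => (1 : ℝ)) (z i)) / n) atTop (𝓝 r))
    {F : DataPoint d → ℝ} {M : ℝ} (hF : ∀ z ∈ D, |F z| ≤ M) {I : ℝ}
    (hFlim : Tendsto (fun n : ℕ => (∑ i ∈ Finset.range n,
      (D ∩ g ⁻¹' Iic c).indicator F (z i)) / n) atTop (𝓝 I)) :
    Tendsto (fun n => 1 / ((A ((Finset.range n).image z) r).card : ℝ) *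
      ∑ x ∈ A ((Finset.range n).image z) r, F x) atTop (𝓝 (I / r)) := by
  obtain ⟨hr0, hr1⟩ := hr
  have hzinj : Function.Injective z := fun i j h => hinj (congrArg g h)
  let Zn : ℕ → Finset (DataPoint d) := fun n => (Finset.range n).image z
  have hZD : ∀ n, (Zn n : Set (DataPoint d)) ⊆ D := by
    intro n x hx
    obtain ⟨i, -, rfl⟩ := Finset.mem_image.1 (Finset.mem_coe.1 hx)
    exact hz i
  have hZcard : ∀ n, (Zn n).card = n := fun n => by
    rw [Finset.card_image_of_injective _ hzinj, Finset.card_range]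
  have hZinj : ∀ n, InjOn g (Zn n : Set (DataPoint d)) := by
    intro n x hx y hy hxy
    obtain ⟨i, -, rfl⟩ := Finset.mem_image.1 (Finset.mem_coe.1 hx)
    obtain ⟨j, -, rfl⟩ := Finset.mem_image.1 (Finset.mem_coe.1 hy)
    rw [hinj hxy]
  let Bn : ℕ → Finset (DataPoint d) := fun n => (Zn n).filter fun x => g x ≤ c
  have hBsum : ∀ (G : DataPoint d → ℝ) (n : ℕ), ∑ x ∈ Bn n, G x =
      ∑ i ∈ Finset.range n, (D ∩ g ⁻¹' Iic c).indicator G (z i) := by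
    intro G n
    rw [Finset.sum_filter, Finset.sum_image hzinj.injOn]
    refine Finset.sum_congr rfl fun i _ => ?_
    simp [indicator, hz i]
  have hBcard : ∀ n, ((Bn n).card : ℝ) =
      ∑ i ∈ Finset.range n, (D ∩ g ⁻¹' Iic c).indicator (fun _ => (1 : ℝ)) (z i) := by
    intro n
    rw [← hBsum]
    simp
  let k : ℕ → ℕ := fun n => ⌊r * (n : ℝ)⌋₊
  have hk : Tendsto (fun n : ℕ => (k n : ℝ) / n) atTop (𝓝 r) :=
    (tendsto_nat_floor_mul_div_atTop hr0.le).comp tendsto_natCast_atTop_atTop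
  have hkpos : ∀ᶠ n in atTop, 1 ≤ k n := by
    filter_upwards [hk.eventually_const_lt hr0] with n hn
    by_contra! hlt
    have : k n = 0 := by omega
    simp [this] at hn
  let An : ℕ → Finset (DataPoint d) := fun n => A (Zn n) r
  have hAn : ∀ᶠ n in atTop, (An n).card = k n ∧
      |∑ x ∈ An n, F x - ∑ x ∈ Bn n, F x| ≤ M * |(k n : ℝ) - (Bn n).card| := by
    filter_upwards [hkpos] with n hn
    have hform := (hA (Zn n) (hZD n) r ⟨hr0, hr1⟩).2 (by rwa [hZcard]) (hZinj n)
    rw [hZcard] at hform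
    have hkn : k n ≤ n := by
      refine Nat.floor_le_of_le ?_
      exact mul_le_of_le_one_left (Nat.cast_nonneg n) hr1
    have hcard : (An n).card = k n := by
      change (A (Zn n) r).card = k n
      rw [hform]
      convert card_filter_le_orderStat (hZinj n) hn (by rwa [hZcard])
    refine ⟨hcard, ?_⟩
    have h := abs_sum_sublevel_sub_le (g := g) (Zn n) (F := F)
      (fun x hx => hF x (hZD n (Finset.mem_coe.2 hx))) (orderStat g (Zn n) (k n)) c
    have hA' : An n = (Zn n).filter fun x => g x ≤ orderStat g (Zn n) (k n) := by
      change A (Zn n) r = _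
      rw [hform]
    rw [← hA', hcard] at h
    exact h
  have hdiff : Tendsto (fun n : ℕ => (∑ x ∈ An n, F x) / n - (∑ x ∈ Bn n, F x) / n) atTop
      (𝓝 0) := by
    have hb : Tendsto (fun n : ℕ => M * |(k n : ℝ) / n - (Bn n).card / n|) atTop (𝓝 0) := by
      have h1 : Tendsto (fun n : ℕ => (k n : ℝ) / n - (Bn n).card / n) atTop (𝓝 (r - r)) := by
        refine hk.sub ?_
        simpa only [hBcard] using hfreq
      rw [sub_self] at h1
      simpa using h1.abs.const_mul M
    refine squeeze_zero_norm' ?_ hb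
    filter_upwards [hAn] with n hn
    rw [← sub_div, ← sub_div, Real.norm_eq_abs, abs_div, abs_div, Nat.abs_cast, ← mul_div_assoc]
    exact div_le_div_of_nonneg_right hn.2 (Nat.cast_nonneg n)
  have hAlim : Tendsto (fun n : ℕ => (∑ x ∈ An n, F x) / n) atTop (𝓝 I) := by
    have h1 : Tendsto (fun n : ℕ => (∑ x ∈ Bn n, F x) / n) atTop (𝓝 I) := by
      simpa only [hBsum] using hFlim
    simpa using hdiff.add h1
  refine (hAlim.div hk hr0.ne').congr' ?_
  filter_upwards [hAn, hkpos] with n hn hkn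
  have hn0 : (n : ℝ) ≠ 0 := by
    rintro h0
    have : k n = 0 := by simp [k, h0]
    omega
  have hk0 : (k n : ℝ) ≠ 0 := by
    have : k n ≠ 0 := by omega
    exact_mod_cast this
  change (∑ x ∈ An n, F x) / n / (k n / n) = 1 / ((An n).card : ℝ) * ∑ x ∈ An n, F x
  rw [hn.1]
  field_simp

theorem abs_average_sub_le {α : Type*} {B : Finset α} {F F' : α → ℝ} {ε : ℝ} (hε : 0 ≤ ε)
    (h : ∀ z ∈ B, |F z - F' z| ≤ ε) :
    |1 / (B.card : ℝ) * ∑ z ∈ B, F z - 1 / (B.card : ℝ) * ∑ z ∈ B, F' z| ≤ ε := by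
  rw [← mul_sub, ← Finset.sum_sub_distrib, abs_mul, abs_of_nonneg (by positivity)]
  have h1 : |∑ z ∈ B, (F z - F' z)| ≤ B.card * ε := by
    refine (Finset.abs_sum_le_sum_abs _ _).trans ?_
    rw [← nsmul_eq_mul]
    exact Finset.sum_le_card_nsmul _ _ _ h
  refine (mul_le_mul_of_nonneg_left h1 (by positivity)).trans ?_
  rw [← mul_assoc]
  refine mul_le_of_le_one_left hε ?_
  rw [one_div_mul_eq_div]
  exact div_self_le_one _

variable {Ω : Type*} [MeasurableSpace Ω] {P : Measure Ω} {Z : ℕ → Ω → DataPoint d}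

theorem IsIIDSample.ae_mem (hZ : IsIIDSample P Z μ) (hμ : IsBinaryProcess X μ p) :
    ∀ᵐ ω ∂P, ∀ i, Z i ω ∈ dataSpace X := by
  refine ae_all_iff.2 fun i => ae_of_ae_map (hZ.meas i).aemeasurable ?_
  rw [hZ.law i]
  exact hμ.ae_mem

/-- Almost surely, all sampled points have distinct scores. -/
theorem IsIIDSample.ae_injective_score [IsProbabilityMeasure P] (hZ : IsIIDSample P Z μ)
    (hX : IsCompact X) (hμ : IsBinaryProcess X μ p) (hg : IsAdapted X g) :
    ∀ᵐ ω ∂P, Function.Injective fun i => g (Z i ω) := by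
  have := hμ.isProb
  have hgm := measurable_indicator_score hX hg.1
  set G := (dataSpace X).indicator g with hG
  have hpair : ∀ i j, i ≠ j → ∀ᵐ ω ∂P, G (Z i ω) ≠ G (Z j ω) := by
    intro i j hij
    have hind := (indepFun_iff_map_prod_eq_prod_map_map (hZ.meas i).aemeasurable
      (hZ.meas j).aemeasurable).1 (hZ.indep.indepFun hij)
    rw [hZ.law i, hZ.law j] at hind
    have hs : MeasurableSet {q : DataPoint d × DataPoint d | G q.1 = G q.2} :=
      measurableSet_eq_fun (hgm.comp measurable_fst) (hgm.comp measurable_snd)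
    have h0 : (μ.prod μ) {q : DataPoint d × DataPoint d | G q.1 = G q.2} = 0 := by
      rw [Measure.measure_prod_null hs]
      refine Eventually.of_forall fun z => ?_
      have h1 := hμ.measure_level_eq_zero hX hg (G z)
      refine measure_mono_null_ae ?_ h1
      filter_upwards [hμ.ae_mem] with z' hz' hmem
      have hmem' : G z = G z' := hmem
      refine ⟨hz', ?_⟩
      rw [hG, indicator_of_mem hz'] at hmem'
      exact hmem'.symm
    have h2 : ∀ᵐ q ∂(P.map fun ω => (Z i ω, Z j ω)), G q.1 ≠ G q.2 := by
      rw [hind]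
      exact measure_eq_zero_iff_ae_notMem.1 h0
    exact ae_of_ae_map ((hZ.meas i).prodMk (hZ.meas j)).aemeasurable h2
  have hall : ∀ᵐ ω ∂P, ∀ i j, i ≠ j → G (Z i ω) ≠ G (Z j ω) :=
    ae_all_iff.2 fun i => ae_all_iff.2 fun j => by
      by_cases hij : i = j
      · exact Eventually.of_forall fun ω h => absurd hij h
      · filter_upwards [hpair i j hij] with ω hω _ using hω
  filter_upwards [hall, hZ.ae_mem hμ] with ω hω hmem i j hij
  by_contra hne
  refine hω i j hne ?_
  rw [hG, indicator_of_mem (hmem i), indicator_of_mem (hmem j)]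
  exact hij

/-- The strong law of large numbers for bounded measurable functions of the data. -/
theorem IsIIDSample.strong_law [IsProbabilityMeasure P] (hZ : IsIIDSample P Z μ)
    {F : DataPoint d → ℝ} (hF : Measurable F) (hFi : Integrable F μ) :
    ∀ᵐ ω ∂P, Tendsto (fun n : ℕ => (∑ i ∈ Finset.range n, F (Z i ω)) / n) atTop
      (𝓝 (∫ z, F z ∂μ)) := by
  have hint : Integrable (fun ω => F (Z 0 ω)) P := by
    rw [← hZ.law 0] at hFi
    exact hFi.comp_measurable (hZ.meas 0)
  have h := strong_law_ae_real (fun i ω => F (Z i ω)) hint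
    (fun i j hij => (hZ.indep.indepFun hij).comp hF hF)
    (fun i => IdentDistrib.comp (u := F) ⟨(hZ.meas i).aemeasurable, (hZ.meas 0).aemeasurable, by
      rw [hZ.law i, hZ.law 0]⟩ hF)
  have hE : ∫ ω, F (Z 0 ω) ∂P = ∫ z, F z ∂μ := by
    rw [← hZ.law 0, integral_map (hZ.meas 0).aemeasurable hF.aestronglyMeasurable]
  rwa [hE] at h

/-- Almost surely, the empirical measures of the kept data converge weakly on the data space to the
restriction of `μ` to the sublevel set `{g ≤ c}` of probability `r`, normalized. -/
theorem IsIIDSample.ae_tendsto_pruned_average [IsProbabilityMeasure P] (hZ : IsIIDSample P Z μ)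
    (hX : IsCompact X) (hμ : IsBinaryProcess X μ p) (hg : IsAdapted X g)
    {A : Finset (DataPoint d) → ℝ → Finset (DataPoint d)} (hA : IsSBPA (dataSpace X) g A) {c r : ℝ}
    (hr : μ.real (dataSpace X ∩ g ⁻¹' Iic c) = r) (hr0 : 0 < r) :
    ∀ᵐ ω ∂P, ∀ F : DataPoint d → ℝ, ContinuousOn F (dataSpace X) →
      Tendsto (fun n => 1 / ((A (dataset Z n ω) r).card : ℝ) * ∑ z ∈ A (dataset Z n ω) r, F z)
        atTop (𝓝 ((∫ z in dataSpace X ∩ g ⁻¹' Iic c, F z ∂μ) / r)) := by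
  classical
  have := hμ.isProb
  set S := dataSpace X ∩ g ⁻¹' Iic c with hS
  have hSm : MeasurableSet S := measurableSet_sublevel hX hg.1 c
  have hr1 : r ≤ 1 := hr ▸ measureReal_le_one
  have hDm := measurableSet_dataSpace hX
  have : CompactSpace (dataSpace X) := isCompact_iff_compactSpace.1 (isCompact_dataSpace hX)
  let e : C(dataSpace X, ℝ) → DataPoint d → ℝ := fun F => Function.extend Subtype.val F 0
  have heq : ∀ (F : C(dataSpace X, ℝ)) (z : DataPoint d) (hz : z ∈ dataSpace X),
      e F z = F ⟨z, hz⟩ := fun F z hz =>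
    Subtype.val_injective.extend_apply F 0 (⟨z, hz⟩ : dataSpace X)
  have hem : ∀ F, Measurable (e F) := fun F =>
    (MeasurableEmbedding.subtype_coe hDm).measurable_extend F.continuous.measurable measurable_const
  have heb : ∀ F, ∀ z ∈ dataSpace X, |e F z| ≤ ‖F‖ := by
    intro F z hz
    rw [heq F z hz]
    exact F.norm_coe_le_norm _
  have hei : ∀ F, Integrable (e F) μ := by
    intro F
    refine Integrable.of_bound (hem F).aestronglyMeasurable ‖F‖ ?_
    filter_upwards [hμ.ae_mem] with z hz using heb F z hz
  have hdense : ∀ᵐ ω ∂P, ∀ j : ℕ,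
      Tendsto (fun n => 1 / ((A (dataset Z n ω) r).card : ℝ) * ∑ z ∈ A (dataset Z n ω) r,
        e (TopologicalSpace.denseSeq C(dataSpace X, ℝ) j) z) atTop
        (𝓝 ((∫ z in S, e (TopologicalSpace.denseSeq C(dataSpace X, ℝ) j) z ∂μ) / r)) := by
    refine ae_all_iff.2 fun j => ?_
    set F := TopologicalSpace.denseSeq C(dataSpace X, ℝ) j
    have h1 := hZ.strong_law (measurable_const.indicator hSm)
      ((integrable_const (1 : ℝ)).indicator hSm)
    have h2 := hZ.strong_law ((hem F).indicator hSm) ((hei F).indicator hSm)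
    rw [integral_indicator_const _ hSm, smul_eq_mul, mul_one, hr] at h1
    rw [integral_indicator hSm] at h2
    filter_upwards [h1, h2, hZ.ae_mem hμ, hZ.ae_injective_score hX hμ hg] with ω w1 w2 w3 w4
    exact tendsto_pruned_average hA (fun i => Z i ω) w3 w4 ⟨hr0, hr1⟩ w1 (heb F) w2
  filter_upwards [hdense, hZ.ae_mem hμ] with ω hω hmem F hF
  have hsub : ∀ n, ∀ z ∈ A (dataset Z n ω) r, z ∈ dataSpace X := by
    have hD : ∀ n, (dataset Z n ω : Set (DataPoint d)) ⊆ dataSpace X := by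
      intro n x hx
      obtain ⟨i, -, rfl⟩ := Finset.mem_image.1 (Finset.mem_coe.1 hx)
      exact hmem i
    exact fun n z hz => hD n (Finset.mem_coe.2 ((hA _ (hD n) r ⟨hr0, hr1⟩).1 hz))
  rw [Metric.tendsto_atTop]
  intro ε hε
  let F₀ : C(dataSpace X, ℝ) := ⟨_, continuousOn_iff_continuous_domRestrict.1 hF⟩
  obtain ⟨j, hj⟩ := (TopologicalSpace.denseRange_denseSeq C(dataSpace X, ℝ)).exists_dist_lt F₀
    (by positivity : 0 < ε / 3)
  set Fj := TopologicalSpace.denseSeq C(dataSpace X, ℝ) j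
  have hFj : ∀ z ∈ dataSpace X, |F z - e Fj z| ≤ ε / 3 := by
    intro z hz
    rw [heq Fj z hz, ← Real.dist_eq]
    exact (ContinuousMap.dist_apply_le_dist (f := F₀) (g := Fj) ⟨z, hz⟩).trans hj.le
  have hFi : Integrable F μ := by
    have hFae : AEStronglyMeasurable F (μ.restrict (dataSpace X)) :=
      hF.aestronglyMeasurable hDm
    rw [Measure.restrict_eq_self_of_ae_mem hμ.ae_mem] at hFae
    refine Integrable.of_bound hFae ‖F₀‖ ?_
    filter_upwards [hμ.ae_mem] with z hz using F₀.norm_coe_le_norm ⟨z, hz⟩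
  have hlim : |(∫ z in S, F z ∂μ) / r - (∫ z in S, e Fj z ∂μ) / r| ≤ ε / 3 := by
    rw [← sub_div, ← integral_sub hFi.restrict (hei Fj).restrict, abs_div, abs_of_pos hr0,
      div_le_iff₀ hr0, ← hr, ← Real.norm_eq_abs]
    refine norm_setIntegral_le_of_norm_le_const (measure_lt_top _ _) fun z hz => ?_
    exact hFj z hz.1
  obtain ⟨N, hN⟩ := (Metric.tendsto_atTop.1 (hω j)) (ε / 3) (by positivity)
  refine ⟨N, fun n hn => ?_⟩
  have h1 := abs_average_sub_le (by positivity) fun z hz => hFj z (hsub n z hz)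
  have h2 := hN n hn
  rw [Real.dist_eq, abs_lt] at h2 ⊢
  rw [abs_le] at h1 hlim
  constructor <;> linarith

end Pruning

/-! ### Pruning and training of wide networks -/

section Networks

variable {d : ℕ} {X : Set (EuclideanSpace ℝ (Fin d))} {μ : Measure (DataPoint d)}
  {p : EuclideanSpace ℝ (Fin d) → ℝ} {g : DataPoint d → ℝ} {loss : ℝ → ℝ → ℝ} {σ ρ : ℝ → ℝ}

/-- A neural network family approximates every predictor in expected loss, as soon as it is wide and
its weights may be large. -/
theorem exists_wide_network_approx (hX : IsCompact X) (hμ : IsBinaryProcess X μ p)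
    {ℓ : ℝ → ℝ → ℝ} (hℓ : Continuous fun y : ℝ × ℝ => ℓ y.1 y.2)
    (hσ : Continuous σ) (hσ_poly : ¬ ∃ q : Polynomial ℝ, ∀ t, σ t = q.eval t)
    {a s : ℝ} (hs : s ≠ 0) (hd : HasDerivAt σ s a) (hρ : IsOutputMap ρ) (H : ℕ)
    {f : EuclideanSpace ℝ (Fin d) → ℝ} (hf : IsPredictor X f) {ε : ℝ} (hε : 0 < ε) :
    ∃ R₀ : ℝ, 0 < R₀ ∧ ∃ K₀ : ℕ, 1 ≤ K₀ ∧ ∀ K : ℕ, K₀ ≤ K → ∀ R : ℝ, R₀ ≤ R →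
      ∃ w ∈ FFNN X σ ρ H K R, ∫ z, |ℓ (ffnnOut σ ρ w z.1) z.2 - ℓ (f z.1) z.2| ∂μ < ε := by
  obtain ⟨⟨K₁, w⟩, hw, hlt⟩ := exists_integral_loss_sub_lt hX hμ hℓ
    (Θ := Σ K, FFNNParam d H K) (yout := fun θ => ffnnOut σ ρ θ.2)
    (fun θ => (continuous_ffnnOut hσ hρ.cont).comp (by fun_prop : Continuous fun x => (θ.2, x)))
    (fun u hu hu01 ε hε => by
      obtain ⟨K, w, hw⟩ := exists_network_approx hX hσ hσ_poly hs hd hρ H hu.continuousOn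
        (fun x _ => hu01 x) hε
      exact ⟨⟨K, w⟩, hw⟩) hf hε
  refine ⟨‖w‖ + 1, by positivity, max K₁ 1, le_max_right _ _, fun K hK R hR => ?_⟩
  obtain ⟨w', hw', hout⟩ := exists_mem_FFNN_of_le w hw ((le_max_left _ _).trans hK)
    ((by linarith : ‖w‖ ≤ ‖w‖ + 1).trans hR)
  refine ⟨w', hw', ?_⟩
  simpa only [hout] using hlt

theorem isPredictor_ffnnOut (hσ : Continuous σ) (hρ : Continuous ρ) {H K : ℕ} {R : ℝ}
    {w : FFNNParam d H K} (hw : w ∈ FFNN X σ ρ H K R) : IsPredictor X (ffnnOut σ ρ w) :=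
  ⟨((continuous_ffnnOut hσ hρ).comp (by fun_prop : Continuous fun x => (w, x))).measurable, hw.2⟩

theorem genLoss_eq_risk (hμ : IsBinaryProcess X μ p) {H K : ℕ} {R : ℝ}
    {w : FFNNParam d H K} (hw : w ∈ FFNN X σ ρ H K R) :
    genLoss loss (ffnnOut σ ρ) μ w = risk (clampLoss loss) μ (ffnnOut σ ρ w) := by
  refine integral_congr_ae ?_
  filter_upwards [hμ.ae_mem] with z hz
  rw [clampLoss_eq (hw.2 _ (mem_dataSpace.1 hz).1) (label_mem_Icc (mem_dataSpace.1 hz).2)]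

theorem avgLoss_eq_clampLoss {H K : ℕ} {R : ℝ} {w : FFNNParam d H K}
    (hw : w ∈ FFNN X σ ρ H K R) {B : Finset (DataPoint d)} (hB : ∀ z ∈ B, z ∈ dataSpace X) :
    avgLoss loss (ffnnOut σ ρ) B w =
      1 / (B.card : ℝ) * ∑ z ∈ B, clampLoss loss (ffnnOut σ ρ w z.1) z.2 := by
  rw [avgLoss]
  congr 1
  refine Finset.sum_congr rfl fun z hz => ?_
  have := mem_dataSpace.1 (hB z hz)
  rw [clampLoss_eq (hw.2 _ this.1) (label_mem_Icc this.2)]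

theorem IsIIDSample.ae_pruned_mem {Ω : Type*} [MeasurableSpace Ω] {P : Measure Ω}
    {Z : ℕ → Ω → DataPoint d} (hZ : IsIIDSample P Z μ) (hμ : IsBinaryProcess X μ p)
    {A : Finset (DataPoint d) → ℝ → Finset (DataPoint d)} (hA : IsSBPA (dataSpace X) g A) {r : ℝ}
    (hr : r ∈ Ioc (0 : ℝ) 1) :
    ∀ᵐ ω ∂P, ∀ n, ∀ z ∈ A (dataset Z n ω) r, z ∈ dataSpace X := by
  classical
  filter_upwards [hZ.ae_mem hμ] with ω hω n z hz
  have hD : (dataset Z n ω : Set (DataPoint d)) ⊆ dataSpace X := by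
    intro x hx
    obtain ⟨i, -, rfl⟩ := Finset.mem_image.1 (Finset.mem_coe.1 hx)
    exact hω i
  exact hD (Finset.mem_coe.2 ((hA _ hD r hr).1 hz))

/-- Almost surely, the pruned loss of every network converges to its normalized risk on the sublevel
set of the score. -/
theorem IsIIDSample.ae_tendsto_prunedLoss {Ω : Type*} [MeasurableSpace Ω] {P : Measure Ω}
    [IsProbabilityMeasure P] {Z : ℕ → Ω → DataPoint d} (hZ : IsIIDSample P Z μ)
    (hX : IsCompact X) (hμ : IsBinaryProcess X μ p) (hg : IsAdapted X g)
    (hloss : ContinuousOn (fun y : ℝ × ℝ => loss y.1 y.2) (Icc (0 : ℝ) 1 ×ˢ Icc (0 : ℝ) 1))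
    (hσ : Continuous σ) (hρ : Continuous ρ)
    {A : Finset (DataPoint d) → ℝ → Finset (DataPoint d)} (hA : IsSBPA (dataSpace X) g A) {c r : ℝ}
    (hr : μ.real (dataSpace X ∩ g ⁻¹' Iic c) = r) (hr0 : 0 < r) (H K : ℕ) (R : ℝ) :
    ∀ᵐ ω ∂P, ∀ w ∈ FFNN X σ ρ H K R,
      Tendsto (fun n => prunedLoss loss (ffnnOut σ ρ) A Z r n ω w) atTop
        (𝓝 (risk (clampLoss loss) (μ.restrict (dataSpace X ∩ g ⁻¹' Iic c))
          (ffnnOut σ ρ w) / r)) := by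
  have := hμ.isProb
  have hr1 : r ≤ 1 := hr ▸ measureReal_le_one
  filter_upwards [hZ.ae_tendsto_pruned_average hX hμ hg hA hr hr0,
    hZ.ae_pruned_mem hμ hA ⟨hr0, hr1⟩] with ω hω hmem w hw
  have hc : Continuous fun z : DataPoint d => clampLoss loss (ffnnOut σ ρ w z.1) z.2 :=
    (continuous_clampLoss hloss).comp (((continuous_ffnnOut hσ hρ).comp
      (by fun_prop : Continuous fun z : DataPoint d => (w, z.1))).prodMk continuous_snd)
  refine (hω _ hc.continuousOn).congr fun n => ?_
  rw [prunedLoss, avgLoss_eq_clampLoss hw (hmem n)]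

theorem tendsto_uniform_loss (hX : IsCompact X)
    {ℓ : ℝ → ℝ → ℝ} (hℓ : Continuous fun y : ℝ × ℝ => ℓ y.1 y.2) (hσ : Continuous σ)
    (hρ : Continuous ρ) {H K : ℕ} {w : ℕ → FFNNParam d H K} {a : FFNNParam d H K}
    (hw : Tendsto w atTop (𝓝 a)) :
    ∃ δ : ℕ → ℝ, (∀ n, 0 ≤ δ n) ∧ Tendsto δ atTop (𝓝 0) ∧ ∀ n, ∀ z ∈ dataSpace X,
      |ℓ (ffnnOut σ ρ (w n) z.1) z.2 - ℓ (ffnnOut σ ρ a z.1) z.2| ≤ δ n := by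
  have : CompactSpace (dataSpace X) := isCompact_iff_compactSpace.1 (isCompact_dataSpace hX)
  let G : C(FFNNParam d H K × dataSpace X, ℝ) :=
    ⟨fun q => ℓ (ffnnOut σ ρ q.1 (q.2 : DataPoint d).1) (q.2 : DataPoint d).2,
      hℓ.comp (((continuous_ffnnOut hσ hρ).comp (by fun_prop : Continuous
        fun q : FFNNParam d H K × dataSpace X => (q.1, (q.2 : DataPoint d).1))).prodMk
        (by fun_prop))⟩
  refine ⟨fun n => dist (G.curry (w n)) (G.curry a), fun n => dist_nonneg,
    tendsto_iff_dist_tendsto_zero.1 ((G.curry.continuous.tendsto a).comp hw), fun n z hz => ?_⟩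
  rw [← Real.dist_eq]
  exact ContinuousMap.dist_apply_le_dist (f := G.curry (w n)) (g := G.curry a) ⟨z, hz⟩

theorem not_isConsistent_of_risk_ne {Ω : Type*} [MeasurableSpace Ω] {P : Measure Ω}
    [IsProbabilityMeasure P] {Z : ℕ → Ω → DataPoint d} (hZ : IsIIDSample P Z μ)
    (hX : IsCompact X) (hμ : IsBinaryProcess X μ p) (hg : IsAdapted X g)
    (hloss : ContinuousOn (fun y : ℝ × ℝ => loss y.1 y.2) (Icc (0 : ℝ) 1 ×ˢ Icc (0 : ℝ) 1))
    (hσ : Continuous σ) (hρ : Continuous ρ)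
    {A : Finset (DataPoint d) → ℝ → Finset (DataPoint d)} (hA : IsSBPA (dataSpace X) g A) {c r : ℝ}
    (hr : μ.real (dataSpace X ∩ g ⁻¹' Iic c) = r) (hr0 : 0 < r) {H K : ℕ} {R : ℝ}
    {w : FFNNParam d H K} (hw : w ∈ FFNN X σ ρ H K R)
    (hne : risk (clampLoss loss) (μ.restrict (dataSpace X ∩ g ⁻¹' Iic c)) (ffnnOut σ ρ w) ≠
      r * risk (clampLoss loss) μ (ffnnOut σ ρ w)) :
    ¬ IsConsistent P Z μ loss A (ffnnOut σ ρ) (FFNN X σ ρ H K R) := by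
  intro hcons
  have := hμ.isProb
  have hr1 : r ≤ 1 := hr ▸ measureReal_le_one
  obtain ⟨ω, h1, h2⟩ := ((hcons r ⟨hr0, hr1⟩ w hw).and
    (hZ.ae_tendsto_prunedLoss hX hμ hg hloss hσ hρ hA hr hr0 H K R)).exists
  have h3 := tendsto_nhds_unique h1 (h2 w hw)
  rw [genLoss_eq_risk hμ hw, eq_div_iff hr0.ne'] at h3
  exact hne (by rw [← h3, mul_comm])

/-- If training on the pruned data is valid, some network minimizes both the risk and the risk
restricted to the sublevel set of the score: any cluster point of the trained parameters does. -/
theorem IsValid.exists_common_minimizer {Ω : Type*} [MeasurableSpace Ω] {P : Measure Ω}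
    [IsProbabilityMeasure P] {Z : ℕ → Ω → DataPoint d} (hZ : IsIIDSample P Z μ)
    (hX : IsCompact X) (hμ : IsBinaryProcess X μ p) (hg : IsAdapted X g)
    (hloss : ContinuousOn (fun y : ℝ × ℝ => loss y.1 y.2) (Icc (0 : ℝ) 1 ×ˢ Icc (0 : ℝ) 1))
    (hloss_i : LossSeparates loss) (hσ : Continuous σ) (hρ : Continuous ρ)
    {A : Finset (DataPoint d) → ℝ → Finset (DataPoint d)} (hA : IsSBPA (dataSpace X) g A) {c r : ℝ}
    (hr : μ.real (dataSpace X ∩ g ⁻¹' Iic c) = r) (hr0 : 0 < r) {H K : ℕ} {R : ℝ} (hR : 0 ≤ R)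
    {train : ℝ → ℕ → Ω → FFNNParam d H K}
    (htrain : IsExactTraining P Z loss A (ffnnOut σ ρ) (FFNN X σ ρ H K R) train)
    (hvalid : IsValid P μ loss (ffnnOut σ ρ) (FFNN X σ ρ H K R) train) :
    ∃ a ∈ FFNN X σ ρ H K R, ∀ w ∈ FFNN X σ ρ H K R,
      risk (clampLoss loss) μ (ffnnOut σ ρ a) ≤ risk (clampLoss loss) μ (ffnnOut σ ρ w) ∧
      risk (clampLoss loss) (μ.restrict (dataSpace X ∩ g ⁻¹' Iic c)) (ffnnOut σ ρ a) ≤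
        risk (clampLoss loss) (μ.restrict (dataSpace X ∩ g ⁻¹' Iic c)) (ffnnOut σ ρ w) := by
  have := hμ.isProb
  have hr1 : r ≤ 1 := hr ▸ measureReal_le_one
  have hℓ := continuous_clampLoss hloss
  set ℓ := clampLoss loss with hℓdef
  set W := FFNN (d := d) X σ ρ H K R with hW
  obtain ⟨ω, ht, hv, hlim, hmem⟩ := ((htrain r ⟨hr0, hr1⟩).and ((hvalid r ⟨hr0, hr1⟩).and
    ((hZ.ae_tendsto_prunedLoss hX hμ hg hloss hσ hρ hA hr hr0 H K R).and
    (hZ.ae_pruned_mem hμ hA ⟨hr0, hr1⟩)))).exists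
  obtain ⟨a, ha, φ, hφ, hφa⟩ := (isCompact_FFNN X hσ hρ H K hR).tendsto_subseq
    (fun n => (ht n).1)
  refine ⟨a, ha, fun w hw => ?_⟩
  obtain ⟨δ, hδ0, hδ, hδle⟩ := tendsto_uniform_loss hX hℓ hσ hρ hφa
  have htW : ∀ n, train r n ω ∈ W := fun n => (ht n).1
  constructor
  · have h1 : Tendsto (fun n => risk ℓ μ (ffnnOut σ ρ (train r (φ n) ω))) atTop
        (𝓝 (risk ℓ μ (ffnnOut σ ρ a))) := by
      refine tendsto_iff_dist_tendsto_zero.2 (squeeze_zero (fun _ => dist_nonneg) (fun n => ?_) hδ)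
      have i1 := (isPredictor_ffnnOut hσ hρ (htW (φ n))).integrable hμ hℓ
      have i2 := (isPredictor_ffnnOut hσ hρ ha).integrable hμ hℓ
      rw [Real.dist_eq, risk, risk, ← integral_sub i1 i2, ← Real.norm_eq_abs]
      have := norm_integral_le_of_norm_le_const (μ := μ) (C := δ n)
        (f := fun z => ℓ (ffnnOut σ ρ (train r (φ n) ω) z.1) z.2 - ℓ (ffnnOut σ ρ a z.1) z.2)
        (by filter_upwards [hμ.ae_mem] with z hz using hδle n z hz)
      simpa using this
    have h2 : Tendsto (fun n => risk ℓ μ (ffnnOut σ ρ (train r (φ n) ω))) atTop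
        (𝓝 (sInf (genLoss loss (ffnnOut σ ρ) μ '' W))) := by
      have h3 := (hv.comp hφ.tendsto_atTop).add_const (sInf (genLoss loss (ffnnOut σ ρ) μ '' W))
      rw [zero_add] at h3
      refine h3.congr fun n => ?_
      simp only [Function.comp, riskGap, sub_add_cancel]
      exact genLoss_eq_risk hμ (htW _)
    rw [tendsto_nhds_unique h1 h2, ← genLoss_eq_risk hμ hw]
    refine csInf_le ⟨0, ?_⟩ ⟨w, hw, rfl⟩
    rintro _ ⟨w', hw', rfl⟩
    rw [genLoss_eq_risk hμ hw', ← Measure.restrict_univ (μ := μ)]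
    exact risk_nonneg hμ hloss_i.clampLoss univ (isPredictor_ffnnOut hσ hρ hw')
  · rw [← div_le_div_iff_of_pos_right hr0]
    have h1 : Tendsto (fun n => prunedLoss loss (ffnnOut σ ρ) A Z r (φ n) ω (train r (φ n) ω)
        - prunedLoss loss (ffnnOut σ ρ) A Z r (φ n) ω a) atTop (𝓝 0) := by
      refine squeeze_zero_norm (fun n => ?_) hδ
      rw [Real.norm_eq_abs, prunedLoss, prunedLoss, avgLoss_eq_clampLoss (htW _) (hmem _),
        avgLoss_eq_clampLoss ha (hmem _)]
      exact abs_average_sub_le (hδ0 n) fun z hz => hδle n z (hmem _ z hz)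
    have h2 := h1.add ((hlim a ha).comp hφ.tendsto_atTop)
    rw [zero_add] at h2
    refine le_of_tendsto_of_tendsto' h2 ((hlim w hw).comp hφ.tendsto_atTop) fun n => ?_
    simp only [Function.comp, sub_add_cancel]
    exact (ht (φ n)).2 w hw

end Networks

theorem mainTheorem10 {d : ℕ} (X : Set (EuclideanSpace ℝ (Fin d))) (hX : IsCompact X)
    (loss : ℝ → ℝ → ℝ)
    (hloss : ContinuousOn (fun y : ℝ × ℝ => loss y.1 y.2) (Icc (0 : ℝ) 1 ×ˢ Icc (0 : ℝ) 1))
    (hloss_i : LossSeparates loss) (hloss_ii : LossHasIncreasingMinimizer loss)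
    (σ : ℝ → ℝ) (hσ : Continuous σ)
    (hσ_poly : ¬ ∃ q : Polynomial ℝ, ∀ t, σ t = q.eval t)
    (hσ_diff : ∃ a : ℝ, (∀ᶠ t in 𝓝 a, DifferentiableAt ℝ σ t) ∧ ContinuousAt (deriv σ) a ∧
      deriv σ a ≠ 0)
    (ρ : ℝ → ℝ) (hρ : IsOutputMap ρ)
    (H : ℕ) (hH : 1 ≤ H)
    (μ : Measure (DataPoint d)) (p : EuclideanSpace ℝ (Fin d) → ℝ) (hμ : IsBinaryProcess X μ p)
    (g : DataPoint d → ℝ) (hg : IsAdapted X g)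
    (A : Finset (DataPoint d) → ℝ → Finset (DataPoint d)) (hA : IsSBPA (dataSpace X) g A) :
    (∃ R₀ : ℝ, 0 < R₀ ∧ ∃ K₀ : ℕ, 1 ≤ K₀ ∧ ∀ K : ℕ, K₀ ≤ K → ∀ R : ℝ, R₀ ≤ R →
      ∀ (Ω : Type*) [MeasurableSpace Ω] (P : Measure Ω) [IsProbabilityMeasure P]
        (Z : ℕ → Ω → DataPoint d), IsIIDSample P Z μ →
        ¬ IsConsistent P Z μ loss A (ffnnOut σ ρ) (FFNN X σ ρ H K R)) ∧
    (DependsOnLabels μ p g →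
      ∃ R₀' : ℝ, 0 < R₀' ∧ ∃ K₀' : ℕ, 1 ≤ K₀' ∧ ∀ K : ℕ, K₀' ≤ K → ∀ R : ℝ, R₀' ≤ R →
        ∀ (Ω : Type*) [MeasurableSpace Ω] (P : Measure Ω) [IsProbabilityMeasure P]
          (Z : ℕ → Ω → DataPoint d), IsIIDSample P Z μ →
          ∀ train : ℝ → ℕ → Ω → FFNNParam d H K,
            IsExactTraining P Z loss A (ffnnOut σ ρ) (FFNN X σ ρ H K R) train →
            ¬ IsValid P μ loss (ffnnOut σ ρ) (FFNN X σ ρ H K R) train) := by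
  have := hμ.isProb
  have hℓ := continuous_clampLoss hloss
  have hℓi := hloss_i.clampLoss
  have hℓii := hloss_ii.clampLoss
  obtain ⟨a, hdiff, -, hs⟩ := hσ_diff
  have hd : HasDerivAt σ (deriv σ a) a := hdiff.self_of_nhds.hasDerivAt
  constructor
  · obtain ⟨c, hS0, hS1⟩ := hμ.exists_sublevel hX hg
    set S := dataSpace X ∩ g ⁻¹' Iic c with hS
    set r := μ.real S with hr
    obtain ⟨f, hf, hne⟩ :=
      exists_risk_restrict_ne hμ hℓi hℓii (measurableSet_sublevel hX hg.1 c) hS0 hS1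
    set γ := |risk (clampLoss loss) (μ.restrict S) f - r * risk (clampLoss loss) μ f| with hγ
    have hγ0 : 0 < γ := abs_pos.2 (sub_ne_zero.2 hne)
    obtain ⟨R₀, hR₀, K₀, hK₀, happ⟩ := exists_wide_network_approx hX hμ hℓ hσ hσ_poly hs hd hρ H hf
      (by positivity : 0 < γ / 3)
    refine ⟨R₀, hR₀, K₀, hK₀, fun K hK R hR Ω _ P _ Z hZ => ?_⟩
    obtain ⟨w, hw, hlt⟩ := happ K hK R hR
    refine not_isConsistent_of_risk_ne hZ hX hμ hg hloss hσ hρ.cont hA hr.symm hS0 hw ?_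
    intro heq
    have hwp := isPredictor_ffnnOut hσ hρ.cont hw
    have h1 := (abs_risk_sub_le hμ hℓ hwp hf S).trans_lt hlt
    have h2 := (abs_risk_sub_le hμ hℓ hwp hf univ).trans_lt hlt
    rw [Measure.restrict_univ] at h2
    have h3 : |r * (risk (clampLoss loss) μ (ffnnOut σ ρ w) - risk (clampLoss loss) μ f)| <
        γ / 3 := by
      rw [abs_mul, abs_of_pos hS0]
      exact (mul_le_of_le_one_left (abs_nonneg _) hS1.le).trans_lt h2
    have h4 : γ ≤ |risk (clampLoss loss) (μ.restrict S) (ffnnOut σ ρ w) -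
          risk (clampLoss loss) (μ.restrict S) f| +
        |r * (risk (clampLoss loss) μ (ffnnOut σ ρ w) - risk (clampLoss loss) μ f)| := by
      rw [hγ, abs_sub_comm (risk (clampLoss loss) (μ.restrict S) (ffnnOut σ ρ w))]
      refine (le_of_eq ?_).trans (abs_add_le _ _)
      rw [heq]
      congr 1
      ring
    linarith
  · intro hlabel
    obtain ⟨c, B, lab, hB, hlab, hSB, hpos, hr0⟩ := hlabel.exists_sublevel hX hμ hg.1
    obtain ⟨f₁, f₂, hf₁, hf₂, ε, hε, hno⟩ := exists_no_common_near_minimizer hX hμ hℓ hℓi hℓii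
      (measurableSet_sublevel hX hg.1 c) hB hlab hSB hpos
    obtain ⟨R₁, hR₁, K₁, hK₁, happ₁⟩ :=
      exists_wide_network_approx hX hμ hℓ hσ hσ_poly hs hd hρ H hf₁ hε
    obtain ⟨R₂, hR₂, K₂, hK₂, happ₂⟩ :=
      exists_wide_network_approx hX hμ hℓ hσ hσ_poly hs hd hρ H hf₂ hε
    refine ⟨max R₁ R₂, lt_max_of_lt_left hR₁, max K₁ K₂, le_max_of_le_left hK₁,
      fun K hK R hR Ω _ P _ Z hZ train htrain hvalid => ?_⟩
    obtain ⟨w₁, hw₁, hlt₁⟩ := happ₁ K (le_of_max_le_left hK) R (le_of_max_le_left hR)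
    obtain ⟨w₂, hw₂, hlt₂⟩ := happ₂ K (le_of_max_le_right hK) R (le_of_max_le_right hR)
    obtain ⟨b, hb, hmin⟩ := IsValid.exists_common_minimizer hZ hX hμ hg hloss hloss_i hσ hρ.cont
      hA rfl hr0 (hR₁.le.trans (le_of_max_le_left hR)) htrain hvalid
    have e1 := (abs_risk_sub_le hμ hℓ (isPredictor_ffnnOut hσ hρ.cont hw₁) hf₁ univ).trans_lt hlt₁
    have e2 := (abs_risk_sub_le hμ hℓ (isPredictor_ffnnOut hσ hρ.cont hw₂) hf₂
      (dataSpace X ∩ g ⁻¹' Iic c)).trans_lt hlt₂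
    rw [Measure.restrict_univ] at e1
    rw [abs_lt] at e1 e2
    have m1 := (hmin w₁ hw₁).1
    have m2 := (hmin w₂ hw₂).2
    have := hno _ (isPredictor_ffnnOut hσ hρ.cont hb) (by linarith)
    linarith
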